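/- Let $1\le m\le n$ be integers, $p>\frac n2$, $p\ge 1$, $\lambda,\sigma,T>0$, and $\mathbb T^n=[0,2\pi]^n$ with periodic boundary conditions. For $j\in\mathbb Z^n$ put $j'=(j_1,\dots,j_m)$; let $u_j$ be the Fourier coefficients of $u=\sum_j u_je^{ij\cdot x}$ and $\hat u=(u_j)_{j\in\mathbb Z^n}$. Let $A=\sqrt{I-\Delta}$, so that $(Au)_j=\sqrt{1+|j|^2}\,u_j$, and $\|u\|_{H^s}^2=\sum_j|u_j|^2(1+|j|^2)^s$. Put $\|\hat u\|_{\ell^1}=\sum_j|u_j|$, and say that $\hat u\in G_\tau(\ell^1)$ if $u\in L^1(\mathbb T^n)$ and $\sum_j e^{\tau|j'|}|u_j|<\infty$. Let $f(t,x,u)=\sum_{j\in\mathbb Z^n}\sum_{k\ge0}a_{jk}(t)u^k e^{ij\cdot x}$, where the $a_{jk}$ are continuous (complex-valued) functions on $[0,T]$ such that $$g(t,s)=\sum_{k=0}^\infty\sum_{j\in\mathbb Z^n}|a_{jk}(t)|(1+|j|^2)^{p/2}e^{\lambda|j'|}s^k$$ converges for all $s\in\mathbb R$, $t\in[0,T]$.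 Let $u_0\in H^p(\mathbb T^n)$, $u_1\in H^{p-1}(\mathbb T^n)$ with $\widehat{Au_0},\widehat{u_1}\in G_\sigma(\ell^1)$. Let $u$ be a (complex-valued) solution (for instance the unique one, if it is known to be unique) of $$u_{tt}-\Delta u+u+f(t,x,u)=0,\qquad u(0)=u_0,\quad u_t(0)=u_1,$$ on $[0,T]$, that is, $u\in C([0,T];H^p)$, $u_t\in C([0,T];H^{p-1})$, $u_{tt}\in C([0,T];H^{p-2})$, the initial conditions hold, and $$\langle u_{tt},\phi\rangle+(Au,A\phi)+\langle f(t,x,u),\phi\rangle=0\qquad\text{for every }\phi\in H^1\text{ and every }t\in[0,T].$$ Assume that $s\mapsto g(s,2e\|\widehat{u(s)}\|_{\ell^1})$ is integrable on $[0,T]$ (which holds whenever $g$ is continuous). Put $\tau_0=\min\{\lambda,\sigma\}$ and $$\tilde h(t)=g\Big(t,\,2y(0)+2\int_0^t g\big(s,2e\|\widehat{u(s)}\|_{\ell^1}\big)\,ds+1\Big),\qquad y(0)=\sum_{j\in\mathbb Z^n}e^{\tau_0|j'|}\big(|(u_1)_j|^2+(1+|j|^2)|(u_0)_j|^2\big)^{1/2}.$$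 If $\tau:[0,T]\to\mathbb R$ is a differentiable function with $$\tau'(t)=-\tau^2(t)\,\tilde h(t)\quad(0\le t\le T),\qquad \tau(0)=\tau_0,$$ then $\widehat{Au(t)}$ and $\widehat{u_t(t)}$ both belong to $G_{\tau(t)}(\ell^1)$ for all $t\in[0,T]$. -/

import Mathlib

open MeasureTheory Set Filter Topology

noncomputable section

namespace WaveGevrey

/-- The torus `𝕋ⁿ`. It is parametrized by `θ = x / (2π) ∈ (ℝ/ℤ)ⁿ`, so that `e^{i j·x}` is the
monomial `UnitAddTorus.mFourier j θ`. -/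
abbrev Torus (n : ℕ) : Type := UnitAddTorus (Fin n)

/-- The normalized Haar measure on `𝕋ⁿ`, the one with respect to which
`UnitAddTorus.mFourierCoeff` is defined. -/
abbrev torusMeasure (n : ℕ) : Measure (Torus n) :=
  Measure.pi fun _ : Fin n => (AddCircle.haarAddCircle : Measure UnitAddCircle)

/-- Complex `L²(𝕋ⁿ)`. -/
abbrev L2 (n : ℕ) : Type := Lp ℂ 2 (torusMeasure n)

/-- Families of Fourier coefficients indexed by `ℤⁿ`. -/
abbrev Coeffs (n : ℕ) : Type := (Fin n → ℤ) → ℂ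

/-- The Fourier coefficients of a function on the torus. -/
def hat {n : ℕ} (v : Torus n → ℂ) : Coeffs n := fun j => UnitAddTorus.mFourierCoeff v j

/-- `1 + |j|²`. -/
def bracketSq {n : ℕ} (j : Fin n → ℤ) : ℝ := 1 + ∑ i, (j i : ℝ) ^ 2

/-- `|j'|`, the Euclidean length of the first `m` components of `j`. -/
def partNorm {n : ℕ} (m : ℕ) (j : Fin n → ℤ) : ℝ :=
  Real.sqrt (∑ i : Fin n, if (i : ℕ) < m then (j i : ℝ) ^ 2 else 0)

/-- The operator `A = √(I - Δ)` on the Fourier side. -/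
def opA {n : ℕ} (c : Coeffs n) : Coeffs n := fun j => (Real.sqrt (bracketSq j) : ℂ) * c j

/-- Membership in the Sobolev space `H^s(𝕋ⁿ)`, `s` real, of the periodic distribution with
coefficients `c`. -/
def MemH {n : ℕ} (s : ℝ) (c : Coeffs n) : Prop :=
  Summable fun j => ‖c j‖ ^ 2 * bracketSq j ^ s

/-- The norm of `H^s(𝕋ⁿ)`. -/
def normH {n : ℕ} (s : ℝ) (c : Coeffs n) : ℝ :=
  Real.sqrt (∑' j, ‖c j‖ ^ 2 * bracketSq j ^ s)

/-- `c ∈ C([0,T]; H^s)`. -/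
def ContinuousInH {n : ℕ} (s T : ℝ) (c : ℝ → Coeffs n) : Prop :=
  (∀ t ∈ Icc 0 T, MemH s (c t)) ∧
    ∀ t ∈ Icc 0 T, Tendsto (fun r => normH s (c r - c t)) (𝓝[Icc 0 T] t) (𝓝 0)

/-- `d` is the derivative of `c` on `[0,T]` with respect to the norm of `H^s`
(one-sided at the end points). -/
def HasTimeDerivInH {n : ℕ} (s T : ℝ) (c d : ℝ → Coeffs n) : Prop :=
  ∀ t ∈ Icc 0 T, Tendsto
    (fun r => normH s (fun j => (c r j - c t j) / ((r - t : ℝ) : ℂ) - d t j))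
    (𝓝[Icc 0 T \ {t}] t) (𝓝 0)

/-- The `ℓ¹` norm of a family of Fourier coefficients. -/
def normL1 {n : ℕ} (c : Coeffs n) : ℝ := ∑' j, ‖c j‖

/-- `c ∈ G_τ(ℓ¹)`: the family `c` consists of the Fourier coefficients of an integrable function,
and `∑_j e^{τ|j'|} |c_j| < ∞`. -/
def MemGevrey {n : ℕ} (m : ℕ) (τ : ℝ) (c : Coeffs n) : Prop :=
  (∃ v : Torus n → ℂ, Integrable v (torusMeasure n) ∧ hat v = c) ∧
    Summable fun j => Real.exp (τ * partNorm m j) * ‖c j‖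

/-- The majorising function
`g(t,s) = ∑_k ∑_j |a_{jk}(t)| (1+|j|²)^{p/2} e^{λ|j'|} s^k`. -/
def majorant {n : ℕ} (m : ℕ) (p lam : ℝ) (a : (Fin n → ℤ) → ℕ → ℝ → ℂ) (t s : ℝ) : ℝ :=
  ∑' k : ℕ, ∑' j : Fin n → ℤ,
    ‖a j k t‖ * bracketSq j ^ (p / 2) * Real.exp (lam * partNorm m j) * s ^ k

/-- The assumption on the coefficients `a_{jk}` of the nonlinearity: they are continuous on
`[0,T]`, and the majorising series converges for all `s ∈ ℝ` and all times. -/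
structure Majorized {n : ℕ} (m : ℕ) (p lam T : ℝ) (a : (Fin n → ℤ) → ℕ → ℝ → ℂ) : Prop where
  continuousOn : ∀ j k, ContinuousOn (a j k) (Icc 0 T)
  summable : ∀ t ∈ Icc 0 T, ∀ s : ℝ, Summable fun q : ℕ × (Fin n → ℤ) =>
    ‖a q.2 q.1 t‖ * bracketSq q.2 ^ (p / 2) * Real.exp (lam * partNorm m q.2) * s ^ q.1

/-- The nonlinearity `f(t,x,z) = ∑_j (∑_k a_{jk}(t) z^k) e^{i j·x}`. -/
def nonlin {n : ℕ} (a : (Fin n → ℤ) → ℕ → ℝ → ℂ) (t : ℝ) (x : Torus n) (z : ℂ) : ℂ :=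
  ∑' j : Fin n → ℤ, (∑' k : ℕ, a j k t * z ^ k) * UnitAddTorus.mFourier j x

/-- The pairing `∑_j c_j conj(d_j)`: the `L²` inner product on the Fourier side, and its extension
to the duality between `H^{-1}` and `H^1`. -/
def pairing {n : ℕ} (c d : Coeffs n) : ℂ := ∑' j, c j * (starRingEnd ℂ) (d j)

/-- `u`, with first and second time derivatives `ut` and `utt`, is a solution on `[0,T]` of
`u_tt - Δu + u + f(t,x,u) = 0`, `u(0) = u₀`, `u_t(0) = u₁`. Since `u(t) ∈ H^p` and
`u_t(t) ∈ H^{p-1}` with `p ≥ 1`, these are `L²` functions; `u_tt(t) ∈ H^{p-2}` is in general only a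
periodic distribution and is given by its Fourier coefficients. -/
structure IsSolution {n : ℕ} (p T : ℝ) (a : (Fin n → ℤ) → ℕ → ℝ → ℂ) (u₀ u₁ : L2 n)
    (u ut : ℝ → L2 n) (utt : ℝ → Coeffs n) : Prop where
  cont : ContinuousInH p T (fun t => hat (u t))
  cont_t : ContinuousInH (p - 1) T (fun t => hat (ut t))
  cont_tt : ContinuousInH (p - 2) T utt
  deriv_t : HasTimeDerivInH (p - 1) T (fun t => hat (u t)) (fun t => hat (ut t))
  deriv_tt : HasTimeDerivInH (p - 2) T (fun t => hat (ut t)) utt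
  init : u 0 = u₀
  init_t : ut 0 = u₁
  weak : ∀ t ∈ Icc 0 T, ∀ φ : L2 n, MemH 1 (hat φ) →
    pairing (utt t) (hat φ) + pairing (opA (hat (u t))) (opA (hat φ))
      + ∫ x, nonlin a t x (u t x) * (starRingEnd ℂ) (φ x) ∂torusMeasure n = 0

/-- `y(0) = ∑_j e^{τ₀|j'|} (|u₁_j|² + (1+|j|²) |u₀_j|²)^{1/2}`. -/
def initialEnergy {n : ℕ} (m : ℕ) (τ₀ : ℝ) (u₀ u₁ : L2 n) : ℝ :=
  ∑' j, Real.exp (τ₀ * partNorm m j) *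
    Real.sqrt (‖hat u₁ j‖ ^ 2 + bracketSq j * ‖hat u₀ j‖ ^ 2)

/-- The function `s ↦ g(s, 2e ‖û(s)‖_{ℓ¹})`. -/
def source {n : ℕ} (m : ℕ) (p lam : ℝ) (a : (Fin n → ℤ) → ℕ → ℝ → ℂ) (u : ℝ → L2 n)
    (s : ℝ) : ℝ :=
  majorant m p lam a s (2 * Real.exp 1 * normL1 (hat (u s)))

/-- `h̃(t) = g(t, 2 y(0) + 2 ∫₀ᵗ g(s, 2e ‖û(s)‖_{ℓ¹}) ds + 1)`. -/
def hTilde {n : ℕ} (m : ℕ) (p lam τ₀ : ℝ) (a : (Fin n → ℤ) → ℕ → ℝ → ℂ) (u₀ u₁ : L2 n)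
    (u : ℝ → L2 n) (t : ℝ) : ℝ :=
  majorant m p lam a t
    (2 * initialEnergy m τ₀ u₀ u₁ + 2 * (∫ s in (0 : ℝ)..t, source m p lam a u s) + 1)

end WaveGevrey

end

/-! ### Absolutely convergent Fourier series and weighted Wiener algebras -/

namespace WaveGevrey

open UnitAddTorus

variable {n : ℕ}

/-! Put `w_j = (|(u_t)_j|² + (1+|j|²)|u_j|²)^{1/2}` and let `F_j` be the Fourier coefficients of
`f(t,x,u)`. Each mode is a forced oscillator, so, in integrated form, `(e^{τφ_j} w_j)' ≤ τ' φ_j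
e^{τφ_j} w_j + e^{τφ_j} |F_j|` for any weight `φ ≥ 0` (`exp_mul_sqrt_energy_le`). After summation
over `j`, the nonpositive term containing `τ'` must absorb the part of the forcing that `source`
does not control.

If `φ` is subadditive, `e^{τφ}` is submultiplicative for `τ ≥ 0` and the weighted `ℓ¹` space is a
convolution algebra. Hence, if also `τ ≤ λ` and `φ_j ≤ |j'|`, `∑ e^{τφ_j}|F_j| ≤ g(t,S)` with `S = ∑
e^{τφ_j}|u_j|` (`IsSolution.weighted_nonlin_le`). Since `e^x ≤ e + x² e^x` and `φ_j|u_j| ≤ w_j`, one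
has `S ≤ α + b` with `α = e‖û‖_{ℓ¹}` and `b = τ² ∑ φ_j e^{τφ_j} w_j`. Now `g(t,S) ≤ g(t,2α) + b
g(t,R)` as soon as `R ≥ max(2S, 1)` (`Majorized.majorant_le_add`). The first term is `source`; with
`R` the argument of `g` in `h̃`, the second is exactly cancelled by `τ' = -τ² h̃`. So `y = ∑
e^{τφ_j} w_j` stays below `y(0) + ∫ source`. The condition `2S ≤ R` holds while `y` exceeds this
bound by at most `1/2`, and continuous induction closes the argument
(`WeightedModes.tsum_le_of_bootstrap`).

To have finite sums from the start, `φ = min(|j'|, N)` is used: the case `φ = 0` bounds the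
unweighted energy, and a bounded weight costs only a constant factor. The final bound does not
depend on `N`, so `N → ∞` gives the weight `e^{τ|j'|}`. -/

lemma norm_mFourier_apply (j : Fin n → ℤ) (x : Torus n) : ‖mFourier j x‖ = 1 := by
  simp [mFourier, norm_prod, Circle.norm_coe, -fourier_apply, fourier_apply]

lemma hat_eq_repr (u : L2 n) (j : Fin n → ℤ) : hat u j = mFourierBasis.repr u j :=
  (mFourierBasis_repr u j).symm

/-- An absolutely convergent Fourier series defines a continuous function whose Fourier
coefficients are the given ones. -/
lemma continuous_and_hat_of_hasSum {c : Coeffs n} {v : Torus n → ℂ}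
    (hc : Summable fun j => ‖c j‖) (hv : ∀ x, HasSum (fun j => c j * mFourier j x) (v x)) :
    Continuous v ∧ hat v = c := by
  have hs : Summable fun j => c j • (mFourier j : C(Torus n, ℂ)) := by
    refine Summable.of_norm ?_
    simpa [norm_smul, mFourier_norm] using hc
  obtain ⟨V, hV⟩ := hs
  have hVv : (V : Torus n → ℂ) = v := by
    funext x
    have := (ContinuousMap.evalCLM ℂ x).hasSum hV
    exact this.unique (hv x)
  subst hVv
  refine ⟨V.continuous, ?_⟩
  funext l
  have h1 := (ContinuousMap.toLp (E := ℂ) 2 (torusMeasure n) ℂ).hasSum hV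
  have h2 : hat V l = mFourierBasis.repr (ContinuousMap.toLp (E := ℂ) 2 (torusMeasure n) ℂ V) l :=
    ((mFourierBasis_repr _ l).trans (mFourierCoeff_toLp V l)).symm
  rw [h2, HilbertBasis.repr_apply_apply]
  have h3 := (innerSL ℂ (mFourierBasis (d := Fin n) l)).hasSum h1
  refine h3.unique ?_
  refine (hasSum_ite_eq l (c l)).congr_fun fun j => ?_
  have h4 := orthonormal_iff_ite.1 (mFourierBasis (d := Fin n)).orthonormal l j
  have h5 : (ContinuousMap.toLp (E := ℂ) 2 (torusMeasure n) ℂ) (c j • mFourier j)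
      = c j • mFourierBasis (d := Fin n) j := by
    rw [map_smul, coe_mFourierBasis]; rfl
  change inner ℂ (mFourierBasis l) ((ContinuousMap.toLp (E := ℂ) 2 (torusMeasure n) ℂ)
    (c j • mFourier j)) = _
  rw [h5, inner_smul_right, h4]
  by_cases h : l = j
  · simp [h]
  · simp [h, Ne.symm h]

lemma summable_mul_mFourier {c : Coeffs n} (hc : Summable fun j => ‖c j‖) (x : Torus n) :
    Summable fun j => c j * mFourier j x :=
  Summable.of_norm (by simpa [norm_mFourier_apply] using hc)

lemma exists_integrable_hat_eq {c : Coeffs n} (hc : Summable fun j => ‖c j‖) :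
    ∃ v : Torus n → ℂ, Integrable v (torusMeasure n) ∧ hat v = c := by
  obtain ⟨h1, h2⟩ := continuous_and_hat_of_hasSum hc
    (v := fun x => ∑' j, c j * mFourier j x) fun x => (summable_mul_mFourier hc x).hasSum
  refine ⟨_, ?_, h2⟩
  exact h1.integrable_of_hasCompactSupport (HasCompactSupport.of_compactSpace _)

/-- An `L²` function with absolutely summable Fourier coefficients is almost everywhere the sum of
its Fourier series. -/
lemma ae_eq_tsum_mFourier (u : L2 n) (hu : Summable fun j => ‖hat u j‖) :
    (u : Torus n → ℂ) =ᵐ[torusMeasure n] fun x => ∑' j, hat u j * mFourier j x := by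
  obtain ⟨h1, h2⟩ := continuous_and_hat_of_hasSum hu
    (v := fun x => ∑' j, hat u j * mFourier j x) fun x => (summable_mul_mFourier hu x).hasSum
  set V : C(Torus n, ℂ) := ⟨_, h1⟩
  have h3 : u = ContinuousMap.toLp (E := ℂ) 2 (torusMeasure n) ℂ V := by
    apply (mFourierBasis (d := Fin n)).repr.injective
    ext l
    have h4 : hat V l
        = mFourierBasis.repr (ContinuousMap.toLp (E := ℂ) 2 (torusMeasure n) ℂ V) l :=
      ((mFourierBasis_repr _ l).trans (mFourierCoeff_toLp V l)).symm
    have h5 := congrFun h2 l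
    exact (mFourierBasis_repr u l).trans (h5.symm.trans h4)
  have h6 := ContinuousMap.coeFn_toLp (p := 2) (𝕜 := ℂ) (torusMeasure n) V
  rw [← h3] at h6
  exact h6

/-- `v` is the sum of a trigonometric series whose weighted `ℓ¹` norm is at most `B`. -/
def HasWienerBound (ω : (Fin n → ℤ) → ℝ) (v : Torus n → ℂ) (B : ℝ) : Prop :=
  ∃ c : Coeffs n, (Summable fun j => ω j * ‖c j‖) ∧ ∑' j, ω j * ‖c j‖ ≤ B ∧
    ∀ x, HasSum (fun j => c j * mFourier j x) (v x)

/-- A submultiplicative weight on `ℤⁿ`. -/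
structure IsSubmulWeight (ω : (Fin n → ℤ) → ℝ) : Prop where
  one_le : ∀ j, 1 ≤ ω j
  zero : ω 0 = 1
  add_le : ∀ j l, ω (j + l) ≤ ω j * ω l

namespace IsSubmulWeight

variable {ω : (Fin n → ℤ) → ℝ}

lemma nonneg (hω : IsSubmulWeight ω) (j : Fin n → ℤ) : 0 ≤ ω j := zero_le_one.trans (hω.one_le j)

lemma summable_norm (hω : IsSubmulWeight ω) {c : Coeffs n} (hc : Summable fun j => ω j * ‖c j‖) :
    Summable fun j => ‖c j‖ :=
  hc.of_nonneg_of_le (fun _ => norm_nonneg _)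
    fun j => le_mul_of_one_le_left (norm_nonneg _) (hω.one_le j)

end IsSubmulWeight

variable {ω : (Fin n → ℤ) → ℝ}

lemma HasWienerBound.hat_bound (hω : IsSubmulWeight ω) {v : Torus n → ℂ} {B : ℝ}
    (h : HasWienerBound ω v B) :
    (Summable fun j => ω j * ‖hat v j‖) ∧ ∑' j, ω j * ‖hat v j‖ ≤ B := by
  obtain ⟨c, h1, h2, h3⟩ := h
  rw [(continuous_and_hat_of_hasSum (hω.summable_norm h1) h3).2]
  exact ⟨h1, h2⟩

/-- Collecting equal frequencies in a trigonometric series does not increase its norm. -/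
lemma hasWienerBound_of_hasSum (hω : IsSubmulWeight ω) {ι : Type*} {κ : ι → Fin n → ℤ} {c : ι → ℂ}
    {v : Torus n → ℂ} (hc : Summable fun i => ω (κ i) * ‖c i‖)
    (hv : ∀ x, HasSum (fun i => c i * mFourier (κ i) x) (v x)) :
    HasWienerBound ω v (∑' i, ω (κ i) * ‖c i‖) := by
  have hcn : Summable fun i => ‖c i‖ := hc.of_nonneg_of_le (fun _ => norm_nonneg _)
    fun i => le_mul_of_one_le_left (norm_nonneg _) (hω.one_le _)
  have h1 := hc.hasSum.tsum_fiberwise κ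
  have h2 : ∀ j, ω j * ‖∑' i : κ ⁻¹' {j}, c i‖ ≤ ∑' i : κ ⁻¹' {j}, ω (κ i) * ‖c i‖ := by
    intro j
    have : ∀ i : κ ⁻¹' {j}, ω (κ i) * ‖c i‖ = ω j * ‖c i‖ := by
      rintro ⟨i, hi⟩
      simp only [mem_preimage, mem_singleton_iff] at hi
      simp [hi]
    rw [tsum_congr this, tsum_mul_left]
    exact mul_le_mul_of_nonneg_left (norm_tsum_le_tsum_norm (hcn.subtype _)) (hω.nonneg j)
  have h3 : Summable fun j => ω j * ‖∑' i : κ ⁻¹' {j}, c i‖ :=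
    h1.summable.of_nonneg_of_le (fun j => mul_nonneg (hω.nonneg j) (norm_nonneg _)) h2
  refine ⟨fun j => ∑' i : κ ⁻¹' {j}, c i, h3, ?_, fun x => ?_⟩
  · rw [← h1.tsum_eq]
    exact h3.tsum_le_tsum h2 h1.summable
  · refine ((hv x).tsum_fiberwise κ).congr_fun fun j => ?_
    rw [← tsum_mul_right]
    refine tsum_congr ?_
    rintro ⟨i, hi⟩
    simp only [mem_preimage, mem_singleton_iff] at hi
    simp [hi]

lemma hasWienerBound_one (hω : IsSubmulWeight ω) : HasWienerBound ω (fun _ => 1) 1 := by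
  have := hasWienerBound_of_hasSum hω (ι := Unit) (κ := fun _ => 0) (c := fun _ => 1)
    (v := fun _ => 1) (Summable.of_finite)
    (fun x => by simp [mFourier_zero])
  simpa [hω.zero] using this

lemma HasWienerBound.nonneg (hω : IsSubmulWeight ω) {v : Torus n → ℂ} {B : ℝ}
    (h : HasWienerBound ω v B) : 0 ≤ B := by
  obtain ⟨c, -, h2, -⟩ := h
  exact (tsum_nonneg fun j => mul_nonneg (hω.nonneg j) (norm_nonneg _)).trans h2

lemma HasWienerBound.mono {v : Torus n → ℂ} {B B' : ℝ} (h : HasWienerBound ω v B) (hB : B ≤ B') :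
    HasWienerBound ω v B' := by
  obtain ⟨c, h1, h2, h3⟩ := h
  exact ⟨c, h1, h2.trans hB, h3⟩

lemma hasSum_mul_of_summable_norm {ι κ : Type*} {f : ι → ℂ} {g : κ → ℂ} {x y : ℂ}
    (hf : HasSum f x) (hg : HasSum g y) (hf' : Summable fun i => ‖f i‖)
    (hg' : Summable fun i => ‖g i‖) : HasSum (fun q : ι × κ => f q.1 * g q.2) (x * y) :=
  hf.mul hg (summable_mul_of_summable_norm hf' hg')

/-- The product series runs over pairs of frequencies `(j, l)` and has frequency `j + l`;
submultiplicativity of `ω` factors its weighted norm. -/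
lemma HasWienerBound.mul (hω : IsSubmulWeight ω) {v w : Torus n → ℂ} {B D : ℝ}
    (hv : HasWienerBound ω v B) (hw : HasWienerBound ω w D) :
    HasWienerBound ω (fun x => v x * w x) (B * D) := by
  have hB := hv.nonneg hω
  obtain ⟨c, c1, c2, c3⟩ := hv
  obtain ⟨d, d1, d2, d3⟩ := hw
  have hnc : ∀ j, 0 ≤ ω j * ‖c j‖ := fun j => mul_nonneg (hω.nonneg j) (norm_nonneg _)
  have hnd : ∀ j, 0 ≤ ω j * ‖d j‖ := fun j => mul_nonneg (hω.nonneg j) (norm_nonneg _)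
  have hsum := c1.mul_of_nonneg d1 hnc hnd
  have hle : ∀ q : (Fin n → ℤ) × (Fin n → ℤ), ω (q.1 + q.2) * ‖c q.1 * d q.2‖
      ≤ (ω q.1 * ‖c q.1‖) * (ω q.2 * ‖d q.2‖) := by
    intro q
    rw [norm_mul, mul_mul_mul_comm]
    exact mul_le_mul_of_nonneg_right (hω.add_le _ _) (by positivity)
  have hs := hsum.of_nonneg_of_le (fun q => mul_nonneg (hω.nonneg _) (norm_nonneg _)) hle
  refine (hasWienerBound_of_hasSum hω (κ := fun q : (Fin n → ℤ) × (Fin n → ℤ) => q.1 + q.2)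
    (c := fun q => c q.1 * d q.2) hs fun x => ?_).mono ?_
  · have e1 : Summable fun j => ‖c j * mFourier j x‖ := by
      simpa only [norm_mul, norm_mFourier_apply, mul_one] using hω.summable_norm c1
    have e2 : Summable fun j => ‖d j * mFourier j x‖ := by
      simpa only [norm_mul, norm_mFourier_apply, mul_one] using hω.summable_norm d1
    refine (hasSum_mul_of_summable_norm (c3 x) (d3 x) e1 e2).congr_fun fun q => ?_
    rw [mFourier_add]; ring
  · calc _ ≤ _ := hs.tsum_le_tsum hle hsum
      _ = (∑' j, ω j * ‖c j‖) * ∑' j, ω j * ‖d j‖ := (c1.tsum_mul_tsum d1 hsum).symm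
      _ ≤ B * D := mul_le_mul c2 d2 (tsum_nonneg hnd) hB

lemma HasWienerBound.pow (hω : IsSubmulWeight ω) {v : Torus n → ℂ} {B : ℝ}
    (hv : HasWienerBound ω v B) (k : ℕ) : HasWienerBound ω (fun x => v x ^ k) (B ^ k) := by
  induction k with
  | zero => simpa using hasWienerBound_one hω
  | succ k ih => simpa [pow_succ] using ih.mul hω hv

/-- The nonlinearity maps the weighted Wiener algebra into itself. -/
lemma HasWienerBound.nonlin (hω : IsSubmulWeight ω) {v : Torus n → ℂ} {B : ℝ}
    (hv : HasWienerBound ω v B) {a : (Fin n → ℤ) → ℕ → ℝ → ℂ} {t : ℝ}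
    (ha : Summable fun q : ℕ × (Fin n → ℤ) => ω q.2 * ‖a q.2 q.1 t‖ * B ^ q.1) :
    HasWienerBound ω (fun x => nonlin a t x (v x))
      (∑' q : ℕ × (Fin n → ℤ), ω q.2 * ‖a q.2 q.1 t‖ * B ^ q.1) := by
  choose c c1 c2 c3 using fun k => hv.pow hω k
  have hnn : ∀ q : (ℕ × (Fin n → ℤ)) × (Fin n → ℤ),
      0 ≤ (ω q.1.2 * ‖a q.1.2 q.1.1 t‖) * (ω q.2 * ‖c q.1.1 q.2‖) := fun q =>
    mul_nonneg (mul_nonneg (hω.nonneg _) (norm_nonneg _))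
      (mul_nonneg (hω.nonneg _) (norm_nonneg _))
  have hin : ∀ q : ℕ × (Fin n → ℤ),
      ∑' l, (ω q.2 * ‖a q.2 q.1 t‖) * (ω l * ‖c q.1 l‖) ≤ ω q.2 * ‖a q.2 q.1 t‖ * B ^ q.1 := by
    intro q
    rw [tsum_mul_left]
    exact mul_le_mul_of_nonneg_left (c2 _) (mul_nonneg (hω.nonneg _) (norm_nonneg _))
  have hins : Summable fun q : ℕ × (Fin n → ℤ) =>
      ∑' l, (ω q.2 * ‖a q.2 q.1 t‖) * (ω l * ‖c q.1 l‖) :=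
    ha.of_nonneg_of_le (fun q => tsum_nonneg fun l => hnn (q, l)) hin
  have hsum : Summable fun q : (ℕ × (Fin n → ℤ)) × (Fin n → ℤ) =>
      (ω q.1.2 * ‖a q.1.2 q.1.1 t‖) * (ω q.2 * ‖c q.1.1 q.2‖) :=
    (summable_prod_of_nonneg hnn).2 ⟨fun q => (c1 q.1).mul_left (ω q.2 * ‖a q.2 q.1 t‖), hins⟩
  have hle : ∀ q : (ℕ × (Fin n → ℤ)) × (Fin n → ℤ),
      ω (q.1.2 + q.2) * ‖a q.1.2 q.1.1 t * c q.1.1 q.2‖ ≤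
        (ω q.1.2 * ‖a q.1.2 q.1.1 t‖) * (ω q.2 * ‖c q.1.1 q.2‖) := by
    intro q
    rw [norm_mul, mul_mul_mul_comm]
    exact mul_le_mul_of_nonneg_right (hω.add_le _ _) (by positivity)
  have hs := hsum.of_nonneg_of_le (fun q => mul_nonneg (hω.nonneg _) (norm_nonneg _)) hle
  have hsn : Summable fun q : (ℕ × (Fin n → ℤ)) × (Fin n → ℤ) =>
      ‖a q.1.2 q.1.1 t * c q.1.1 q.2‖ := hs.of_nonneg_of_le (fun _ => norm_nonneg _)
    fun i => le_mul_of_one_le_left (norm_nonneg _) (hω.one_le _)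
  -- The composite is expanded over triples `(k, j, l)`, with `l` the frequency in the series of `v
  -- ^ k`, and then regrouped by the total frequency `j + l`.
  refine (hasWienerBound_of_hasSum hω
    (κ := fun q : (ℕ × (Fin n → ℤ)) × (Fin n → ℤ) => q.1.2 + q.2)
    (c := fun q => a q.1.2 q.1.1 t * c q.1.1 q.2) hs fun x => ?_).mono ?_
  · have hsx : Summable fun q : (ℕ × (Fin n → ℤ)) × (Fin n → ℤ) =>
        a q.1.2 q.1.1 t * c q.1.1 q.2 * mFourier (q.1.2 + q.2) x :=
      Summable.of_norm (by simpa only [norm_mul, norm_mFourier_apply, mul_one] using hsn)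
    have h1 := hsx.hasSum.prod_fiberwise
      (g := fun q : ℕ × (Fin n → ℤ) => a q.2 q.1 t * mFourier q.2 x * v x ^ q.1) fun q => by
        refine ((c3 q.1 x).mul_left (a q.2 q.1 t * mFourier q.2 x)).congr_fun fun l => ?_
        rw [mFourier_add]; ring
    -- `nonlin` sums over `k` inside the sum over `j`, whereas `h1` is indexed by `(k, j)`.
    have h2 := (Equiv.prodComm (Fin n → ℤ) ℕ).hasSum_iff.2 h1
    have h3 := h2.prod_fiberwise (fun j => (h2.summable.prod_factor j).hasSum)
    have h4 : WaveGevrey.nonlin a t x (v x) = ∑' q : (ℕ × (Fin n → ℤ)) × (Fin n → ℤ),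
        a q.1.2 q.1.1 t * c q.1.1 q.2 * mFourier (q.1.2 + q.2) x := by
      rw [WaveGevrey.nonlin, ← h3.tsum_eq]
      refine tsum_congr fun j => ?_
      rw [← tsum_mul_right]
      refine tsum_congr fun k => ?_
      simp only [Function.comp, Equiv.prodComm_apply, Prod.swap]
      ring
    rw [h4]
    exact hsx.hasSum
  · calc _ ≤ _ := hs.tsum_le_tsum hle hsum
      _ = ∑' q : ℕ × (Fin n → ℤ), ∑' l, (ω q.2 * ‖a q.2 q.1 t‖) * (ω l * ‖c q.1 l‖) :=
        hsum.tsum_prod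
      _ ≤ _ := hins.tsum_le_tsum hin ha

end WaveGevrey

/-! ### Sobolev coefficients, the equation mode by mode, and the majorant -/

namespace WaveGevrey

open UnitAddTorus

variable {n : ℕ}

lemma one_le_bracketSq (j : Fin n → ℤ) : 1 ≤ bracketSq j :=
  le_add_of_nonneg_right (Finset.sum_nonneg fun _ _ => sq_nonneg _)

lemma bracketSq_pos (j : Fin n → ℤ) : 0 < bracketSq j := zero_lt_one.trans_le (one_le_bracketSq j)

lemma summable_prod_apply {f : ℤ → ℝ} (hf : Summable f) (hf0 : ∀ k, 0 ≤ f k) (n : ℕ) :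
    Summable fun j : Fin n → ℤ => ∏ i, f (j i) := by
  induction n with
  | zero => exact Summable.of_finite
  | succ n ih =>
    rw [← (Fin.consEquiv fun _ : Fin (n + 1) => ℤ).summable_iff]
    refine (hf.mul_of_nonneg ih hf0 fun j => Finset.prod_nonneg fun i _ => hf0 _).congr fun q => ?_
    simp [Fin.prod_univ_succ, Fin.consEquiv]

lemma summable_one_add_sq_rpow {q : ℝ} (hq : 1 / 2 < q) :
    Summable fun k : ℤ => (1 + (k : ℝ) ^ 2) ^ (-q) := by
  have h1 : Summable fun k : ℤ => |(k : ℝ)| ^ (-(2 * q)) :=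
    Real.summable_abs_int_rpow (by linarith)
  refine Summable.of_norm_bounded_eventually h1 ?_
  -- The comparison fails at `k = 0`, where the negative real power of `0` has the value `0`.
  filter_upwards [(Set.finite_singleton (0 : ℤ)).compl_mem_cofinite] with k hk
  have hk' : (0 : ℝ) < |(k : ℝ)| := abs_pos.2 (by simpa using hk)
  have h2 : |(k : ℝ)| ^ (-(2 * q)) = ((k : ℝ) ^ 2) ^ (-q) := by
    rw [← sq_abs (k : ℝ), ← Real.rpow_natCast, ← Real.rpow_mul hk'.le]
    congr 1; push_cast; ring
  rw [h2, Real.norm_of_nonneg (by positivity)]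
  refine Real.rpow_le_rpow_of_nonpos ?_ (by linarith) (by linarith)
  rw [← sq_abs]; positivity

/-- The exponent is shared equally among the `n` coordinates. Each share `p/n` exceeds `1/2`, and
`1+|j|² ≥ 1+j_i²`, so a product of convergent one-dimensional series dominates. -/
lemma summable_bracketSq_rpow {p : ℝ} (hn : 1 ≤ n) (hp : (n : ℝ) / 2 < p) :
    Summable fun j : Fin n → ℤ => bracketSq j ^ (-p) := by
  have hn' : (0 : ℝ) < n := by exact_mod_cast hn
  have hq : 1 / 2 < p / n := by rw [lt_div_iff₀ hn']; linarith
  refine (summable_prod_apply (summable_one_add_sq_rpow hq) (fun k => by positivity) n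
    ).of_nonneg_of_le (fun j => Real.rpow_nonneg (bracketSq_pos j).le _) fun j => ?_
  calc bracketSq j ^ (-p) = ∏ _i : Fin n, bracketSq j ^ (-(p / n)) := by
        rw [Finset.prod_const, Finset.card_univ, Fintype.card_fin, ← Real.rpow_natCast,
          ← Real.rpow_mul (bracketSq_pos j).le]
        congr 1; field_simp
    _ ≤ _ := by
        refine Finset.prod_le_prod (fun i _ => Real.rpow_nonneg (bracketSq_pos j).le _)
          fun i _ => Real.rpow_le_rpow_of_nonpos (by positivity) ?_ (by linarith)
        exact add_le_add_right (Finset.single_le_sum (f := fun i => (j i : ℝ) ^ 2)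
          (fun _ _ => sq_nonneg _) (Finset.mem_univ i)) 1

lemma rpow_half_sq (s : ℝ) (j : Fin n → ℤ) : (bracketSq j ^ (s / 2)) ^ 2 = bracketSq j ^ s := by
  rw [← Real.rpow_natCast, ← Real.rpow_mul (bracketSq_pos j).le]
  congr 1; push_cast; ring

/-- The embedding `H^p ⊆ ℱ⁻¹ ℓ¹` for `p > n/2`. -/
lemma MemH.summable_norm {p : ℝ} (hn : 1 ≤ n) (hp : (n : ℝ) / 2 < p) {c : Coeffs n}
    (hc : MemH p c) : Summable fun j => ‖c j‖ := by
  refine (hc.add (summable_bracketSq_rpow hn hp)).of_nonneg_of_le (fun _ => norm_nonneg _)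
    fun j => ?_
  rw [← rpow_half_sq p, ← rpow_half_sq (-p), neg_div, Real.rpow_neg (bracketSq_pos j).le]
  have hb : 0 < bracketSq j ^ (p / 2) := Real.rpow_pos_of_pos (bracketSq_pos j) _
  set b := bracketSq j ^ (p / 2)
  have h1 : ‖c j‖ = (‖c j‖ * b) * b⁻¹ := by field_simp
  have h2 : 0 ≤ (‖c j‖ * b) * b⁻¹ := by positivity
  -- `xy ≤ x² + y²` with `x = |c_j| b` and `y = 1/b`.
  nlinarith [sq_nonneg (‖c j‖ * b - b⁻¹)]

lemma MemH.mono {s s' : ℝ} (h : s' ≤ s) {c : Coeffs n} (hc : MemH s c) : MemH s' c :=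
  hc.of_nonneg_of_le (fun j => mul_nonneg (sq_nonneg _) (Real.rpow_nonneg (bracketSq_pos j).le _))
    fun j => mul_le_mul_of_nonneg_left (Real.rpow_le_rpow_of_exponent_le (one_le_bracketSq j) h)
      (sq_nonneg _)

lemma MemH.sub {s : ℝ} {c d : Coeffs n} (hc : MemH s c) (hd : MemH s d) : MemH s (c - d) := by
  refine ((hc.add hd).mul_left 2).of_nonneg_of_le
    (fun j => mul_nonneg (sq_nonneg _) (Real.rpow_nonneg (bracketSq_pos j).le _)) fun j => ?_
  rw [← add_mul, ← mul_assoc]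
  refine mul_le_mul_of_nonneg_right ?_ (Real.rpow_nonneg (bracketSq_pos j).le _)
  have h1 : ‖(c - d) j‖ ≤ ‖c j‖ + ‖d j‖ := norm_sub_le _ _
  nlinarith [norm_nonneg ((c - d) j), sq_nonneg (‖c j‖ - ‖d j‖), norm_nonneg (c j),
    norm_nonneg (d j)]

lemma MemH.div_const {s : ℝ} {c : Coeffs n} (hc : MemH s c) (z : ℂ) :
    MemH s (fun j => c j / z) := by
  refine (hc.mul_left ((‖z‖ ^ 2)⁻¹)).congr fun j => ?_
  rw [norm_div, div_pow]; ring

/-- Passes from `H^s` convergence to single modes, for negative `s` as well. The `j`-dependence of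
the constant is harmless because modes are differentiated one at a time. -/
lemma MemH.norm_mul_le_normH {s : ℝ} {c : Coeffs n} (hc : MemH s c) (j : Fin n → ℤ) :
    ‖c j‖ * bracketSq j ^ (s / 2) ≤ normH s c := by
  refine Real.le_sqrt_of_sq_le ?_
  rw [mul_pow, rpow_half_sq]
  exact hc.le_tsum j fun l _ =>
    mul_nonneg (sq_nonneg _) (Real.rpow_nonneg (bracketSq_pos l).le _)

lemma MemH.norm_le_normH {s : ℝ} {c : Coeffs n} (hc : MemH s c) (j : Fin n → ℤ) :
    ‖c j‖ ≤ normH s c / bracketSq j ^ (s / 2) := by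
  rw [le_div_iff₀ (Real.rpow_pos_of_pos (bracketSq_pos j) _)]
  exact hc.norm_mul_le_normH j

lemma ContinuousInH.continuousOn_apply {s T : ℝ} {c : ℝ → Coeffs n} (hc : ContinuousInH s T c)
    (j : Fin n → ℤ) : ContinuousOn (fun t => c t j) (Icc 0 T) := by
  intro t ht
  rw [ContinuousWithinAt, tendsto_iff_norm_sub_tendsto_zero]
  refine squeeze_zero' (Eventually.of_forall fun _ => norm_nonneg _) ?_
    (by simpa using (hc.2 t ht).div_const (bracketSq j ^ (s / 2)))
  filter_upwards [self_mem_nhdsWithin] with r hr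
  exact ((hc.1 r hr).sub (hc.1 t ht)).norm_le_normH j

lemma HasTimeDerivInH.hasDerivWithinAt_apply {s T : ℝ} {c d : ℝ → Coeffs n}
    (h : HasTimeDerivInH s T c d) (hc : ∀ t ∈ Icc 0 T, MemH s (c t))
    (hd : ∀ t ∈ Icc 0 T, MemH s (d t)) (j : Fin n → ℤ) {t : ℝ} (ht : t ∈ Icc 0 T) :
    HasDerivWithinAt (fun r => c r j) (d t j) (Icc 0 T) t := by
  rw [hasDerivWithinAt_iff_tendsto_slope, tendsto_iff_norm_sub_tendsto_zero]
  have h0 := (h t ht).div_const (bracketSq j ^ (s / 2))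
  rw [zero_div] at h0
  refine squeeze_zero' (Eventually.of_forall fun _ => norm_nonneg _) ?_ h0
  filter_upwards [self_mem_nhdsWithin] with r hr
  have h1 := ((((hc r hr.1).sub (hc t ht)).div_const ((r - t : ℝ) : ℂ)).sub
    (hd t ht)).norm_le_normH j
  refine le_trans (le_of_eq ?_) h1
  change _ = ‖(c r j - c t j) / ((r - t : ℝ) : ℂ) - d t j‖
  simp only [slope, vsub_eq_sub, Complex.real_smul]
  congr 2
  push_cast
  rw [div_eq_mul_inv, mul_comm]

lemma hat_mFourierLp (l : Fin n → ℤ) :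
    hat (mFourierLp (d := Fin n) 2 l : L2 n) = Pi.single l (1 : ℂ) := by
  funext j
  rw [hat_eq_repr, ← coe_mFourierBasis, HilbertBasis.repr_self]
  simp [lp.single_apply, Pi.single_apply]

lemma memH_single (s : ℝ) (l : Fin n → ℤ) : MemH s (Pi.single l (1 : ℂ) : Coeffs n) := by
  refine summable_of_ne_finset_zero (s := {l}) fun j hj => ?_
  rw [Pi.single_eq_of_ne (by simpa using hj)]
  simp

lemma pairing_single (c : Coeffs n) (l : Fin n → ℤ) (z : ℂ) :
    pairing c (Pi.single l z) = c l * (starRingEnd ℂ) z := by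
  rw [pairing, tsum_eq_single l fun j hj => by rw [Pi.single_eq_of_ne hj]; simp]
  simp

lemma opA_single (l : Fin n → ℤ) :
    opA (Pi.single l (1 : ℂ) : Coeffs n) = Pi.single l (Real.sqrt (bracketSq l) : ℂ) := by
  funext j
  by_cases h : j = l
  · subst h; simp [opA]
  · simp [opA, Pi.single_eq_of_ne h]

/-- The weak formulation tested with `e^{i l·x}`. -/
lemma IsSolution.coeff_eq {p T : ℝ} {a : (Fin n → ℤ) → ℕ → ℝ → ℂ} {u₀ u₁ : L2 n}
    {u ut : ℝ → L2 n} {utt : ℝ → Coeffs n} (h : IsSolution p T a u₀ u₁ u ut utt) {t : ℝ}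
    (ht : t ∈ Icc 0 T) {U : Torus n → ℂ} (hU : (u t : Torus n → ℂ) =ᵐ[torusMeasure n] U)
    (l : Fin n → ℤ) :
    utt t l + bracketSq l * hat (u t) l = -hat (fun x => nonlin a t x (U x)) l := by
  have h1 := h.weak t ht (mFourierLp (d := Fin n) 2 l)
    (by rw [hat_mFourierLp]; exact memH_single 1 l)
  rw [hat_mFourierLp, opA_single, pairing_single, pairing_single] at h1
  have h2 : ∫ x, nonlin a t x (u t x) *
      (starRingEnd ℂ) ((mFourierLp (d := Fin n) 2 l : L2 n) x) ∂torusMeasure n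
        = hat (fun x => nonlin a t x (U x)) l := by
    refine integral_congr_ae ?_
    have h3 : ((mFourierLp (d := Fin n) 2 l : L2 n) : Torus n → ℂ) =ᵐ[torusMeasure n]
      mFourier l := coeFn_mFourierLp 2 l
    filter_upwards [hU, h3] with x hx hx'
    rw [hx, hx', ← mFourier_neg, smul_eq_mul, mul_comm]
  rw [h2] at h1
  have h4 : ((Real.sqrt (bracketSq l) : ℝ) : ℂ) * (Real.sqrt (bracketSq l) : ℝ)
      = (bracketSq l : ℝ) := by
    rw [← Complex.ofReal_mul, Real.mul_self_sqrt (bracketSq_pos l).le]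
  simp only [opA, map_one, mul_one, Complex.conj_ofReal] at h1
  rw [← h4]
  linear_combination h1

lemma bracket_exp_nonneg (m : ℕ) (p lam : ℝ) (z : ℂ) (j : Fin n → ℤ) :
    0 ≤ ‖z‖ * bracketSq j ^ (p / 2) * Real.exp (lam * partNorm m j) :=
  mul_nonneg (mul_nonneg (norm_nonneg _) (Real.rpow_nonneg (bracketSq_pos j).le _))
    (Real.exp_pos _).le

lemma Majorized.majorant_eq {m : ℕ} {p lam T : ℝ} {a : (Fin n → ℤ) → ℕ → ℝ → ℂ}
    (ha : Majorized m p lam T a) {t : ℝ} (ht : t ∈ Icc 0 T) (s : ℝ) :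
    majorant m p lam a t s = ∑' q : ℕ × (Fin n → ℤ),
      ‖a q.2 q.1 t‖ * bracketSq q.2 ^ (p / 2) * Real.exp (lam * partNorm m q.2) * s ^ q.1 :=
  (ha.summable t ht s).tsum_prod.symm

lemma majorant_nonneg {m : ℕ} {p lam : ℝ} {a : (Fin n → ℤ) → ℕ → ℝ → ℂ} {t s : ℝ} (hs : 0 ≤ s) :
    0 ≤ majorant m p lam a t s :=
  tsum_nonneg fun _ => tsum_nonneg fun _ =>
    mul_nonneg (bracket_exp_nonneg _ _ _ _ _) (pow_nonneg hs _)

lemma Majorized.majorant_mono {m : ℕ} {p lam T : ℝ} {a : (Fin n → ℤ) → ℕ → ℝ → ℂ}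
    (ha : Majorized m p lam T a) {t : ℝ} (ht : t ∈ Icc 0 T) {s r : ℝ} (hs : 0 ≤ s) (h : s ≤ r) :
    majorant m p lam a t s ≤ majorant m p lam a t r := by
  rw [ha.majorant_eq ht, ha.majorant_eq ht]
  exact (ha.summable t ht s).tsum_le_tsum (fun q => mul_le_mul_of_nonneg_left
    (pow_le_pow_left₀ hs h _) (bracket_exp_nonneg _ _ _ _ _)) (ha.summable t ht r)

/-- A quasi-convexity estimate for the majorant, linear in the possibly large quantity `b`. -/
lemma Majorized.majorant_le_add {m : ℕ} {p lam T : ℝ} {a : (Fin n → ℤ) → ℕ → ℝ → ℂ}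
    (ha : Majorized m p lam T a) {t : ℝ} (ht : t ∈ Icc 0 T) {s α b R : ℝ} (hs : 0 ≤ s)
    (hα : 0 ≤ α) (hb : 0 ≤ b) (hsb : s ≤ α + b) (hsR : 2 * s ≤ R) (hR : 1 ≤ R) :
    majorant m p lam a t s ≤ majorant m p lam a t (2 * α) + b * majorant m p lam a t R := by
  -- Power by power: if `b ≤ α` then `s ≤ 2α`; otherwise `s ≤ 2b`, and one factor `s` is traded for
  -- `2b`, the `2` being absorbed by `2s ≤ R`. That absorption needs another factor `s`, so
  -- exponents `0` and `1` are treated directly.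
  have hpow : ∀ k : ℕ, s ^ k ≤ (2 * α) ^ k + b * R ^ k := by
    intro k
    rcases le_total b α with h | h
    · have h1 : s ^ k ≤ (2 * α) ^ k := pow_le_pow_left₀ hs (by linarith) k
      have h2 : 0 ≤ b * R ^ k := by positivity
      linarith
    · match k with
      | 0 => simpa using hb
      | 1 => nlinarith
      | k + 2 =>
        have h0 : 0 ≤ (2 * α) ^ (k + 2) := by positivity
        have h1 : 2 * s ^ (k + 1) ≤ R ^ (k + 2) := by
          have h2 : (2 * s) ^ (k + 1) ≤ R ^ (k + 1) := pow_le_pow_left₀ (by positivity) hsR _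
          have h3 : R ^ (k + 1) ≤ R ^ (k + 2) := pow_le_pow_right₀ hR (by omega)
          have h4 : 2 * s ^ (k + 1) ≤ (2 * s) ^ (k + 1) := by
            rw [mul_pow]
            exact mul_le_mul_of_nonneg_right (le_self_pow₀ (by norm_num) (by omega))
              (pow_nonneg hs _)
          linarith
        have h5 : s ^ (k + 2) ≤ (2 * b) * s ^ (k + 1) := by
          rw [pow_succ' s (k + 1)]
          exact mul_le_mul_of_nonneg_right (by linarith) (pow_nonneg hs _)
        nlinarith
  rw [ha.majorant_eq ht, ha.majorant_eq ht, ha.majorant_eq ht, ← tsum_mul_left,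
    ← (ha.summable t ht _).tsum_add ((ha.summable t ht _).mul_left b)]
  refine (ha.summable t ht s).tsum_le_tsum (fun q => ?_)
    ((ha.summable t ht _).add ((ha.summable t ht _).mul_left b))
  have := mul_le_mul_of_nonneg_left (hpow q.1)
    (bracket_exp_nonneg m p lam (a q.2 q.1 t) q.2)
  linarith

/-- The weighted `ℓ¹` norm of the nonlinear term is controlled by the majorant. -/
lemma IsSolution.weighted_nonlin_le {m : ℕ} {p lam T : ℝ} (hn : 1 ≤ n) (hp : (n : ℝ) / 2 < p)
    (hp0 : 0 ≤ p) {a : (Fin n → ℤ) → ℕ → ℝ → ℂ} (ha : Majorized m p lam T a) {u₀ u₁ : L2 n}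
    {u ut : ℝ → L2 n} {utt : ℝ → Coeffs n} (h : IsSolution p T a u₀ u₁ u ut utt) {t : ℝ}
    (ht : t ∈ Icc 0 T) {ω : (Fin n → ℤ) → ℝ} (hω : IsSubmulWeight ω)
    (hωl : ∀ j, ω j ≤ Real.exp (lam * partNorm m j))
    (hs : Summable fun j => ω j * ‖hat (u t) j‖) :
    (Summable fun j => ω j * ‖utt t j + bracketSq j * hat (u t) j‖) ∧
      ∑' j, ω j * ‖utt t j + bracketSq j * hat (u t) j‖
        ≤ majorant m p lam a t (∑' j, ω j * ‖hat (u t) j‖) := by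
  have hsn := (h.cont.1 t ht).summable_norm hn hp
  set S := ∑' j, ω j * ‖hat (u t) j‖
  have hS : 0 ≤ S := tsum_nonneg fun j => mul_nonneg (hω.nonneg j) (norm_nonneg _)
  have hU : HasWienerBound ω (fun x => ∑' j, hat (u t) j * mFourier j x) S :=
    ⟨_, hs, le_rfl, fun x => (summable_mul_mFourier hsn x).hasSum⟩
  have hle : ∀ q : ℕ × (Fin n → ℤ), ω q.2 * ‖a q.2 q.1 t‖ * S ^ q.1 ≤
      ‖a q.2 q.1 t‖ * bracketSq q.2 ^ (p / 2) * Real.exp (lam * partNorm m q.2) * S ^ q.1 := by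
    intro q
    refine mul_le_mul_of_nonneg_right ?_ (pow_nonneg hS _)
    have h1 : 1 ≤ bracketSq q.2 ^ (p / 2) :=
      Real.one_le_rpow (one_le_bracketSq _) (by linarith)
    calc ω q.2 * ‖a q.2 q.1 t‖ ≤ Real.exp (lam * partNorm m q.2) * ‖a q.2 q.1 t‖ :=
          mul_le_mul_of_nonneg_right (hωl _) (norm_nonneg _)
      _ = ‖a q.2 q.1 t‖ * 1 * Real.exp (lam * partNorm m q.2) := by ring
      _ ≤ _ := by gcongr
  have hsum : Summable fun q : ℕ × (Fin n → ℤ) => ω q.2 * ‖a q.2 q.1 t‖ * S ^ q.1 :=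
    (ha.summable t ht S).of_nonneg_of_le (fun q => mul_nonneg (mul_nonneg (hω.nonneg _)
      (norm_nonneg _)) (pow_nonneg hS _)) hle
  obtain ⟨h2, h3⟩ := (hU.nonlin hω hsum).hat_bound hω
  have h4 : ∀ j, ‖utt t j + bracketSq j * hat (u t) j‖ = ‖hat (fun x => WaveGevrey.nonlin a t x
      (∑' j, hat (u t) j * mFourier j x)) j‖ := fun j => by
    rw [h.coeff_eq ht (ae_eq_tsum_mFourier (u t) hsn) j, norm_neg]
  simp only [h4]
  refine ⟨h2, h3.trans ?_⟩
  rw [ha.majorant_eq ht]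
  exact hsum.tsum_le_tsum hle (ha.summable t ht S)

end WaveGevrey

/-! ### The energy inequality for a single mode -/

namespace WaveGevrey

lemma continuousOn_sqrt_energy {x y : ℝ → ℂ} {b : ℝ} {K : Set ℝ} (hx : ContinuousOn x K)
    (hy : ContinuousOn y K) (ε : ℝ) :
    ContinuousOn (fun r => Real.sqrt (‖y r‖ ^ 2 + b * ‖x r‖ ^ 2 + ε)) K := by
  fun_prop

/-- The weighted energy inequality for one Fourier mode `x'' + b x = z + b x`. -/
lemma exp_mul_sqrt_energy_le {s t b φ : ℝ} (hst : s ≤ t) (hb : 0 ≤ b) (hφ : 0 ≤ φ)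
    {x y z : ℝ → ℂ} {τ τ' : ℝ → ℝ}
    (hx : ∀ r ∈ Icc s t, HasDerivWithinAt x (y r) (Icc s t) r)
    (hy : ∀ r ∈ Icc s t, HasDerivWithinAt y (z r) (Icc s t) r)
    (hz : ContinuousOn z (Icc s t))
    (hτ : ∀ r ∈ Icc s t, HasDerivWithinAt τ (τ' r) (Icc s t) r)
    (hτ0 : ∀ r ∈ Icc s t, τ' r ≤ 0) (hτi : IntegrableOn τ' (Icc s t)) :
    Real.exp (τ t * φ) * Real.sqrt (‖y t‖ ^ 2 + b * ‖x t‖ ^ 2) ≤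
      Real.exp (τ s * φ) * Real.sqrt (‖y s‖ ^ 2 + b * ‖x s‖ ^ 2) +
        ∫ r in s..t, (τ' r * (φ * (Real.exp (τ r * φ) * Real.sqrt (‖y r‖ ^ 2 + b * ‖x r‖ ^ 2)))
          + Real.exp (τ r * φ) * ‖z r + b * x r‖) := by
  have cx : ContinuousOn x (Icc s t) := fun r hr => (hx r hr).continuousWithinAt
  have cy : ContinuousOn y (Icc s t) := fun r hr => (hy r hr).continuousWithinAt
  have cτ : ContinuousOn τ (Icc s t) := fun r hr => (hτ r hr).continuousWithinAt
  set J := ∫ r in s..t, (τ' r * (φ * (Real.exp (τ r * φ) *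
    Real.sqrt (‖y r‖ ^ 2 + b * ‖x r‖ ^ 2))) + Real.exp (τ r * φ) * ‖z r + b * x r‖)
  -- The shift `ε` keeps the square root differentiable where the energy vanishes. Because `τ' ≤ 0`,
  -- the shift can be dropped from the integrand.
  have key : ∀ ε : ℝ, 0 < ε → Real.exp (τ t * φ) * Real.sqrt (‖y t‖ ^ 2 + b * ‖x t‖ ^ 2) ≤
      Real.exp (τ s * φ) * Real.sqrt (‖y s‖ ^ 2 + b * ‖x s‖ ^ 2 + ε) + J := by
    intro ε hε
    have hE : ∀ r, 0 < ‖y r‖ ^ 2 + b * ‖x r‖ ^ 2 + ε := fun r => by positivity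
    -- This form of the fundamental theorem needs only an integrable upper bound on the derivative,
    -- so `τ'` need not be continuous.
    have h1 := intervalIntegral.sub_le_integral_of_hasDeriv_right_of_le hst
      (g := fun r => Real.exp (τ r * φ) * Real.sqrt (‖y r‖ ^ 2 + b * ‖x r‖ ^ 2 + ε))
      (g' := fun r => Real.exp (τ r * φ) * (τ' r * φ) *
          Real.sqrt (‖y r‖ ^ 2 + b * ‖x r‖ ^ 2 + ε) + Real.exp (τ r * φ) *
          ((2 * inner ℝ (y r) (z r) + b * (2 * inner ℝ (x r) (y r))) /
            (2 * Real.sqrt (‖y r‖ ^ 2 + b * ‖x r‖ ^ 2 + ε))))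
      (φ := fun r => τ' r * (φ * (Real.exp (τ r * φ) * Real.sqrt (‖y r‖ ^ 2 + b * ‖x r‖ ^ 2)))
          + Real.exp (τ r * φ) * ‖z r + b * x r‖)
      (by fun_prop) ?_ ?_ ?_
    · have h2 : Real.exp (τ t * φ) * Real.sqrt (‖y t‖ ^ 2 + b * ‖x t‖ ^ 2) ≤
          Real.exp (τ t * φ) * Real.sqrt (‖y t‖ ^ 2 + b * ‖x t‖ ^ 2 + ε) := by
        exact mul_le_mul_of_nonneg_left (Real.sqrt_le_sqrt (by linarith)) (Real.exp_pos _).le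
      linarith
    · intro r hr
      have hr' := Ioo_subset_Icc_self hr
      have hn := Icc_mem_nhds hr.1 hr.2
      have dx := (hx r hr').hasDerivAt hn
      have dy := (hy r hr').hasDerivAt hn
      have dτ := (hτ r hr').hasDerivAt hn
      have dE := ((dy.norm_sq).add ((dx.norm_sq).const_mul b)).add_const ε
      exact (((dτ.mul_const φ).exp).mul (dE.sqrt (hE r).ne')).hasDerivWithinAt
    · refine Integrable.add ?_ ?_
      · refine hτi.mul_continuousOn (by fun_prop) isCompact_Icc
      · exact ContinuousOn.integrableOn_Icc (by fun_prop)
    · intro r hr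
      have hr' := Ioo_subset_Icc_self hr
      set e := Real.exp (τ r * φ)
      set q := Real.sqrt (‖y r‖ ^ 2 + b * ‖x r‖ ^ 2 + ε)
      have he : 0 < e := Real.exp_pos _
      have hq : 0 < q := Real.sqrt_pos.2 (hE r)
      have hyq : ‖y r‖ ≤ q := Real.le_sqrt_of_sq_le (by
        have : 0 ≤ b * ‖x r‖ ^ 2 := by positivity
        linarith)
      -- The potential-energy term combines with `z` into the forcing `z + b x`, which is then
      -- bounded by Cauchy–Schwarz.
      have hin : 2 * inner ℝ (y r) (z r) + b * (2 * inner ℝ (x r) (y r))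
          = 2 * inner ℝ (y r) (z r + b * x r) := by
        have : (b : ℂ) * x r = b • x r := rfl
        rw [this, inner_add_right, inner_smul_right, real_inner_comm (x r) (y r)]
        ring
      have h3 : (2 * inner ℝ (y r) (z r) + b * (2 * inner ℝ (x r) (y r))) / (2 * q)
          ≤ ‖z r + b * x r‖ := by
        rw [div_le_iff₀ (by positivity), hin]
        have h4 := real_inner_le_norm (y r) (z r + b * x r)
        have h5 := mul_le_mul_of_nonneg_right hyq (norm_nonneg (z r + b * x r))
        linarith
      have h6 : Real.sqrt (‖y r‖ ^ 2 + b * ‖x r‖ ^ 2) ≤ q := Real.sqrt_le_sqrt (by linarith)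
      have h7 : τ' r * (φ * (e * q)) ≤
          τ' r * (φ * (e * Real.sqrt (‖y r‖ ^ 2 + b * ‖x r‖ ^ 2))) :=
        mul_le_mul_of_nonpos_left (by gcongr) (hτ0 r hr')
      have h8 := mul_le_mul_of_nonneg_left h3 he.le
      calc _ = τ' r * (φ * (e * q)) + e * ((2 * inner ℝ (y r) (z r) +
            b * (2 * inner ℝ (x r) (y r))) / (2 * q)) := by ring
        _ ≤ _ := add_le_add h7 h8
  have hlim : Tendsto (fun ε : ℝ => Real.exp (τ s * φ) *
      Real.sqrt (‖y s‖ ^ 2 + b * ‖x s‖ ^ 2 + ε) + J) (𝓝[>] 0)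
      (𝓝 (Real.exp (τ s * φ) * Real.sqrt (‖y s‖ ^ 2 + b * ‖x s‖ ^ 2) + J)) := by
    have : Continuous fun ε : ℝ => Real.exp (τ s * φ) *
      Real.sqrt (‖y s‖ ^ 2 + b * ‖x s‖ ^ 2 + ε) + J := by fun_prop
    simpa using (this.tendsto 0).mono_left nhdsWithin_le_nhds
  refine ge_of_tendsto hlim ?_
  filter_upwards [self_mem_nhdsWithin] with ε hε using key ε hε

/-- `e^{τφ}`-weighted modal energies obeying the modal energy inequality. -/
structure WeightedModes {ι : Type*} (R : ℝ) (φ : ι → ℝ) (w F : ι → ℝ → ℝ) (τ τ' : ℝ → ℝ) :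
    Prop where
  cont_w : ∀ i, ContinuousOn (w i) (Icc 0 R)
  cont_F : ∀ i, ContinuousOn (F i) (Icc 0 R)
  cont_τ : ContinuousOn τ (Icc 0 R)
  int_τ' : IntegrableOn τ' (Icc 0 R)
  τ'_nonpos : ∀ t ∈ Icc 0 R, τ' t ≤ 0
  w_nonneg : ∀ i, ∀ t ∈ Icc 0 R, 0 ≤ w i t
  F_nonneg : ∀ i, ∀ t ∈ Icc 0 R, 0 ≤ F i t
  φ_nonneg : ∀ i, 0 ≤ φ i
  energy : ∀ i, ∀ s ∈ Icc 0 R, ∀ t ∈ Icc 0 R, s ≤ t →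
    Real.exp (τ t * φ i) * w i t ≤ Real.exp (τ s * φ i) * w i s +
      ∫ r in s..t, (τ' r * (φ i * (Real.exp (τ r * φ i) * w i r)) + Real.exp (τ r * φ i) * F i r)

/-! ### Summation over modes and continuous induction -/

namespace WeightedModes

variable {ι : Type*} {R : ℝ} {φ : ι → ℝ} {w F : ι → ℝ → ℝ} {τ τ' src : ℝ → ℝ}

/-- The time derivative bound of a mode. -/
noncomputable def rate (φ : ι → ℝ) (w F : ι → ℝ → ℝ) (τ τ' : ℝ → ℝ) (i : ι) (r : ℝ) : ℝ :=
  τ' r * (φ i * (Real.exp (τ r * φ i) * w i r)) + Real.exp (τ r * φ i) * F i r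

lemma integrableOn_rate (h : WeightedModes R φ w F τ τ') (i : ι) :
    IntegrableOn (rate φ w F τ τ' i) (Icc 0 R) := by
  have c1 := h.cont_w i
  have c2 := h.cont_F i
  have c3 := h.cont_τ
  refine Integrable.add ?_ ?_
  · exact h.int_τ'.mul_continuousOn (by fun_prop) isCompact_Icc
  · exact ContinuousOn.integrableOn_Icc (by fun_prop)

lemma intervalIntegrable_of_integrableOn {f : ℝ → ℝ} (hf : IntegrableOn f (Icc 0 R)) {s t : ℝ}
    (hs : s ∈ Icc 0 R) (ht : t ∈ Icc 0 R) (hst : s ≤ t) : IntervalIntegrable f volume s t := by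
  rw [intervalIntegrable_iff, uIoc_of_le hst]
  exact hf.mono_set (Ioc_subset_Icc_self.trans (Icc_subset_Icc hs.1 ht.2))

lemma sum_energy (h : WeightedModes R φ w F τ τ') (A : Finset ι) {s t : ℝ} (hs : s ∈ Icc 0 R)
    (ht : t ∈ Icc 0 R) (hst : s ≤ t) :
    ∑ i ∈ A, Real.exp (τ t * φ i) * w i t ≤ ∑ i ∈ A, Real.exp (τ s * φ i) * w i s +
      ∫ r in s..t, ∑ i ∈ A, rate φ w F τ τ' i r := by
  rw [intervalIntegral.integral_finsetSum fun i _ =>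
    intervalIntegrable_of_integrableOn (h.integrableOn_rate i) hs ht hst,
    ← Finset.sum_add_distrib]
  exact Finset.sum_le_sum fun i _ => h.energy i s hs t ht hst

/-- If the forcing is bounded by `src`, so is the growth of the total weighted energy. -/
lemma sum_le_of_forcing_le (h : WeightedModes R φ w F τ τ') (hsrc : IntegrableOn src (Icc 0 R))
    {s t : ℝ} (hs : s ∈ Icc 0 R) (ht : t ∈ Icc 0 R) (hst : s ≤ t)
    (hF : ∀ r ∈ Icc s t, ∀ A : Finset ι, ∑ i ∈ A, Real.exp (τ r * φ i) * F i r ≤ src r)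
    (A : Finset ι) :
    ∑ i ∈ A, Real.exp (τ t * φ i) * w i t ≤ ∑ i ∈ A, Real.exp (τ s * φ i) * w i s +
      ∫ r in s..t, src r := by
  refine (h.sum_energy A hs ht hst).trans (add_le_add_right ?_ _)
  refine intervalIntegral.integral_mono_on hst ?_
    (intervalIntegrable_of_integrableOn hsrc hs ht hst) fun r hr => ?_
  · exact intervalIntegrable_of_integrableOn
      (integrable_finsetSum A fun i _ => h.integrableOn_rate i) hs ht hst
  · have hr' : r ∈ Icc 0 R := ⟨hs.1.trans hr.1, hr.2.trans ht.2⟩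
    refine le_trans (Finset.sum_le_sum fun i _ => ?_) (hF r hr A)
    refine add_le_of_nonpos_left (mul_nonpos_of_nonpos_of_nonneg (h.τ'_nonpos r hr') ?_)
    exact mul_nonneg (h.φ_nonneg i) (mul_nonneg (Real.exp_pos _).le (h.w_nonneg i r hr'))

/-- Growth of the total weighted energy when part of the forcing is absorbed by the shrinking
radius `τ`. -/
lemma tsum_le_of_absorbed [Countable ι] (h : WeightedModes R φ w F τ τ')
    (hsrc : IntegrableOn src (Icc 0 R)) {N C W : ℝ} (hN : ∀ i, φ i ≤ N) (hC : 0 ≤ C)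
    (hexp : ∀ t ∈ Icc 0 R, ∀ i, Real.exp (τ t * φ i) ≤ C)
    (hw : ∀ t ∈ Icc 0 R, Summable fun i => w i t) (hW : ∀ t ∈ Icc 0 R, ∑' i, w i t ≤ W)
    (hF : ∀ t ∈ Icc 0 R, Summable fun i => F i t) (hFsrc : ∀ t ∈ Icc 0 R, ∑' i, F i t ≤ src t)
    {s t : ℝ} (hs : s ∈ Icc 0 R) (ht : t ∈ Icc 0 R) (hst : s ≤ t)
    (habs : ∀ r ∈ Icc s t, ∑' i, Real.exp (τ r * φ i) * F i r ≤
      src r - τ' r * ∑' i, φ i * (Real.exp (τ r * φ i) * w i r)) :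
    ∑' i, Real.exp (τ t * φ i) * w i t ≤ ∑' i, Real.exp (τ s * φ i) * w i s +
      ∫ r in s..t, src r := by
  have hEw : ∀ r ∈ Icc 0 R, ∀ i, Real.exp (τ r * φ i) * w i r ≤ C * w i r := fun r hr i =>
    mul_le_mul_of_nonneg_right (hexp r hr i) (h.w_nonneg i r hr)
  have hEF : ∀ r ∈ Icc 0 R, ∀ i, Real.exp (τ r * φ i) * F i r ≤ C * F i r := fun r hr i =>
    mul_le_mul_of_nonneg_right (hexp r hr i) (h.F_nonneg i r hr)
  have nEw : ∀ r ∈ Icc 0 R, ∀ i, 0 ≤ Real.exp (τ r * φ i) * w i r := fun r hr i =>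
    mul_nonneg (Real.exp_pos _).le (h.w_nonneg i r hr)
  have nEF : ∀ r ∈ Icc 0 R, ∀ i, 0 ≤ Real.exp (τ r * φ i) * F i r := fun r hr i =>
    mul_nonneg (Real.exp_pos _).le (h.F_nonneg i r hr)
  have sEw : ∀ r ∈ Icc 0 R, Summable fun i => Real.exp (τ r * φ i) * w i r := fun r hr =>
    ((hw r hr).mul_left C).of_nonneg_of_le (nEw r hr) (hEw r hr)
  have sEF : ∀ r ∈ Icc 0 R, Summable fun i => Real.exp (τ r * φ i) * F i r := fun r hr =>
    ((hF r hr).mul_left C).of_nonneg_of_le (nEF r hr) (hEF r hr)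
  have nφ : ∀ r ∈ Icc 0 R, ∀ i, 0 ≤ φ i * (Real.exp (τ r * φ i) * w i r) := fun r hr i =>
    mul_nonneg (h.φ_nonneg i) (nEw r hr i)
  have hφ : ∀ r ∈ Icc 0 R, ∀ i, φ i * (Real.exp (τ r * φ i) * w i r) ≤ N * (C * w i r) :=
    fun r hr i => mul_le_mul (hN i) (hEw r hr i) (nEw r hr i) ((h.φ_nonneg i).trans (hN i))
  have sφ : ∀ r ∈ Icc 0 R, Summable fun i => φ i * (Real.exp (τ r * φ i) * w i r) :=
    fun r hr => (((hw r hr).mul_left C).mul_left N).of_nonneg_of_le (nφ r hr) (hφ r hr)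
  rcases isEmpty_or_nonempty ι with hι | ⟨⟨i₀⟩⟩
  · have h1 : ∀ r ∈ Icc s t, 0 ≤ src r := fun r hr => by
      simpa using hFsrc r ⟨hs.1.trans hr.1, hr.2.trans ht.2⟩
    simpa using intervalIntegral.integral_nonneg hst h1
  have hN0 : 0 ≤ N := (h.φ_nonneg i₀).trans (hN i₀)
  have hsub : ∀ r ∈ Icc s t, r ∈ Icc 0 R := fun r hr => ⟨hs.1.trans hr.1, hr.2.trans ht.2⟩
  set D : ℝ → ℝ := fun r => τ' r * ∑' i, φ i * (Real.exp (τ r * φ i) * w i r) +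
    ∑' i, Real.exp (τ r * φ i) * F i r
  have hrate : ∀ r ∈ Icc 0 R, HasSum (fun i => rate φ w F τ τ' i r) (D r) := fun r hr =>
    ((sφ r hr).hasSum.mul_left _).add (sEF r hr).hasSum
  -- Dominates all partial sums of the rates, using the bounds `N` on `φ`, `C` on the exponentials
  -- and `W` on the unweighted energy.
  set G : ℝ → ℝ := fun r => |τ' r| * (N * (C * W)) + C * src r
  have hGi : IntegrableOn G (Icc 0 R) := (h.int_τ'.abs.mul_const _).add (hsrc.const_mul C)
  have hmeas : ∀ A : Finset ι, IntervalIntegrable (fun r => ∑ i ∈ A, rate φ w F τ τ' i r)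
      volume s t := fun A => intervalIntegrable_of_integrableOn
        (integrable_finsetSum A fun i _ => h.integrableOn_rate i) hs ht hst
  -- Absorption is assumed for full sums only, so the limit over finite sets is taken before it is
  -- used. Countability of `ι` makes this filter countably generated, as dominated convergence
  -- requires.
  have hlim : Tendsto (fun A : Finset ι => ∫ r in s..t, ∑ i ∈ A, rate φ w F τ τ' i r) atTop
      (𝓝 (∫ r in s..t, D r)) := by
    refine intervalIntegral.tendsto_integral_filter_of_dominated_convergence G
      (Eventually.of_forall fun A => (hmeas A).def'.aestronglyMeasurable)
      (Eventually.of_forall fun A => ?_) (intervalIntegrable_of_integrableOn hGi hs ht hst)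
      (Eventually.of_forall fun r hr => ?_)
    · refine Eventually.of_forall fun r hr => ?_
      rw [uIoc_of_le hst] at hr
      have hr' := hsub r (Ioc_subset_Icc_self hr)
      have e1 : ∑ i ∈ A, rate φ w F τ τ' i r
          = τ' r * (∑ i ∈ A, φ i * (Real.exp (τ r * φ i) * w i r)) +
            ∑ i ∈ A, Real.exp (τ r * φ i) * F i r := by
        simp only [rate, Finset.sum_add_distrib, Finset.mul_sum]
      have e2 : ∑ i ∈ A, φ i * (Real.exp (τ r * φ i) * w i r) ≤ N * (C * W) := by
        calc _ ≤ ∑ i ∈ A, N * (C * w i r) := Finset.sum_le_sum fun i _ => hφ r hr' i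
          _ = N * (C * ∑ i ∈ A, w i r) := by simp only [Finset.mul_sum]
          _ ≤ N * (C * W) := by
            gcongr
            exact ((hw r hr').sum_le_tsum A fun i _ => h.w_nonneg i r hr').trans (hW r hr')
      have e3 : ∑ i ∈ A, Real.exp (τ r * φ i) * F i r ≤ C * src r := by
        calc _ ≤ ∑ i ∈ A, C * F i r := Finset.sum_le_sum fun i _ => hEF r hr' i
          _ = C * ∑ i ∈ A, F i r := by simp only [Finset.mul_sum]
          _ ≤ C * src r := by
            gcongr
            exact ((hF r hr').sum_le_tsum A fun i _ => h.F_nonneg i r hr').trans (hFsrc r hr')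
      rw [e1]
      refine (norm_add_le _ _).trans (add_le_add ?_ ?_)
      · rw [norm_mul, Real.norm_eq_abs, Real.norm_of_nonneg
          (Finset.sum_nonneg fun i _ => nφ r hr' i)]
        gcongr
      · rwa [Real.norm_of_nonneg (Finset.sum_nonneg fun i _ => nEF r hr' i)]
    · rw [uIoc_of_le hst] at hr
      exact hrate r (hsub r (Ioc_subset_Icc_self hr))
  have hDi : IntervalIntegrable D volume s t := by
    refine (intervalIntegrable_of_integrableOn hGi hs ht hst).mono_fun ?_ ?_
    · refine aestronglyMeasurable_of_tendsto_ae atTop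
        (fun A : Finset ι => (hmeas A).def'.aestronglyMeasurable) ?_
      refine (ae_restrict_iff' measurableSet_uIoc).2 (Eventually.of_forall fun r hr => ?_)
      rw [uIoc_of_le hst] at hr
      exact hrate r (hsub r (Ioc_subset_Icc_self hr))
    · refine (ae_restrict_iff' measurableSet_uIoc).2 (Eventually.of_forall fun r hr => ?_)
      rw [uIoc_of_le hst] at hr
      have hr' := hsub r (Ioc_subset_Icc_self hr)
      have e2 : ∑' i, φ i * (Real.exp (τ r * φ i) * w i r) ≤ N * (C * W) := by
        calc _ ≤ ∑' i, N * (C * w i r) :=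
              (sφ r hr').tsum_le_tsum (hφ r hr') (((hw r hr').mul_left C).mul_left N)
          _ = N * (C * ∑' i, w i r) := by simp only [tsum_mul_left]
          _ ≤ N * (C * W) := by gcongr; exact hW r hr'
      have e3 : ∑' i, Real.exp (τ r * φ i) * F i r ≤ C * src r := by
        calc _ ≤ ∑' i, C * F i r := (sEF r hr').tsum_le_tsum (hEF r hr') ((hF r hr').mul_left C)
          _ = C * ∑' i, F i r := tsum_mul_left
          _ ≤ C * src r := by gcongr; exact hFsrc r hr'
      refine (norm_add_le _ _).trans ((add_le_add ?_ ?_).trans (le_abs_self _))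
      · rw [norm_mul, Real.norm_eq_abs, Real.norm_of_nonneg (tsum_nonneg (nφ r hr'))]
        gcongr
      · rwa [Real.norm_of_nonneg (tsum_nonneg (nEF r hr'))]
  have hD : ∫ r in s..t, D r ≤ ∫ r in s..t, src r :=
    intervalIntegral.integral_mono_on hst hDi
      (intervalIntegrable_of_integrableOn hsrc hs ht hst) fun r hr => by
        have := habs r hr
        simp only [D]; linarith
  refine le_trans ?_ (add_le_add_right hD _)
  exact le_of_tendsto_of_tendsto' (sEw t ht).hasSum (Tendsto.add (sEw s hs).hasSum hlim)
    fun A => h.sum_energy A hs ht hst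

/-- Continuous induction: the absorption hypothesis is only needed as long as the total weighted
energy stays close to its claimed bound. -/
lemma tsum_le_of_bootstrap [Countable ι] (h : WeightedModes R φ w F τ τ')
    (hsrc : IntegrableOn src (Icc 0 R)) {N C W y₀ : ℝ} (hN : ∀ i, φ i ≤ N) (hC : 0 ≤ C)
    (hexp : ∀ t ∈ Icc 0 R, ∀ i, Real.exp (τ t * φ i) ≤ C)
    (hw : ∀ t ∈ Icc 0 R, Summable fun i => w i t) (hW : ∀ t ∈ Icc 0 R, ∑' i, w i t ≤ W)
    (hF : ∀ t ∈ Icc 0 R, Summable fun i => F i t) (hFsrc : ∀ t ∈ Icc 0 R, ∑' i, F i t ≤ src t)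
    (hy₀ : ∑' i, Real.exp (τ 0 * φ i) * w i 0 ≤ y₀)
    (habs : ∀ r ∈ Icc 0 R,
      ∑' i, Real.exp (τ r * φ i) * w i r ≤ y₀ + (∫ s in (0 : ℝ)..r, src s) + 1 / 2 →
      ∑' i, Real.exp (τ r * φ i) * F i r ≤
        src r - τ' r * ∑' i, φ i * (Real.exp (τ r * φ i) * w i r)) :
    ∀ t ∈ Icc 0 R, ∑' i, Real.exp (τ t * φ i) * w i t ≤ y₀ + ∫ s in (0 : ℝ)..t, src s := by
  intro t₁ ht₁
  have hR : (0 : ℝ) ≤ R := ht₁.1.trans ht₁.2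
  have h0 : (0 : ℝ) ∈ Icc 0 R := ⟨le_rfl, hR⟩
  have hsrc0 : ∀ t ∈ Icc 0 R, 0 ≤ src t := fun t ht =>
    (tsum_nonneg fun i => h.F_nonneg i t ht).trans (hFsrc t ht)
  have nEw : ∀ r ∈ Icc 0 R, ∀ i, 0 ≤ Real.exp (τ r * φ i) * w i r := fun r hr i =>
    mul_nonneg (Real.exp_pos _).le (h.w_nonneg i r hr)
  have sEw : ∀ r ∈ Icc 0 R, Summable fun i => Real.exp (τ r * φ i) * w i r := fun r hr =>
    ((hw r hr).mul_left C).of_nonneg_of_le (nEw r hr) fun i =>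
      mul_le_mul_of_nonneg_right (hexp r hr i) (h.w_nonneg i r hr)
  have hint : ∀ s ∈ Icc 0 R, ∀ t ∈ Icc 0 R, s ≤ t → IntervalIntegrable src volume s t :=
    fun s hs t ht hst => intervalIntegrable_of_integrableOn hsrc hs ht hst
  set P : ℝ → ℝ := fun t => ∫ s in (0 : ℝ)..t, src s
  have hPadd : ∀ s ∈ Icc 0 R, ∀ t ∈ Icc 0 R, s ≤ t → P s + ∫ r in s..t, src r = P t :=
    fun s hs t ht hst => intervalIntegral.integral_add_adjacent_intervals
      (hint 0 h0 s hs hs.1) (hint s hs t ht hst)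
  have hPc : ContinuousOn P (Icc 0 R) := by
    have := intervalIntegral.continuousOn_primitive_interval (f := src) (a := 0) (b := R)
      (μ := volume) (by rwa [uIcc_of_le hR])
    rwa [uIcc_of_le hR] at this
  set y : ℝ → ℝ := fun t => ∑' i, Real.exp (τ t * φ i) * w i t
  -- A bound free of the absorption hypothesis: `y` cannot jump upwards, although its continuity is
  -- not known.
  have hcrude : ∀ s ∈ Icc 0 R, ∀ t ∈ Icc 0 R, s ≤ t → y t ≤ y s + C * (P t - P s) := by
    intro s hs t ht hst
    have h1 : ∀ A : Finset ι, ∑ i ∈ A, Real.exp (τ t * φ i) * w i t ≤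
        y s + C * (P t - P s) := by
      intro A
      have h2 := h.sum_le_of_forcing_le (src := fun r => C * src r) (hsrc.const_mul C) hs ht hst
        (fun r hr A => ?_) A
      · rw [intervalIntegral.integral_const_mul] at h2
        have h3 := (sEw s hs).sum_le_tsum A fun i _ => nEw s hs i
        have h4 : ∫ r in s..t, src r = P t - P s := by rw [← hPadd s hs t ht hst]; ring
        rw [h4] at h2
        linarith
      · have hr' : r ∈ Icc 0 R := ⟨hs.1.trans hr.1, hr.2.trans ht.2⟩
        calc _ ≤ ∑ i ∈ A, C * F i r := Finset.sum_le_sum fun i _ =>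
              mul_le_mul_of_nonneg_right (hexp r hr' i) (h.F_nonneg i r hr')
          _ = C * ∑ i ∈ A, F i r := by simp only [Finset.mul_sum]
          _ ≤ C * src r := by
            gcongr
            exact ((hF r hr').sum_le_tsum A fun i _ => h.F_nonneg i r hr').trans (hFsrc r hr')
    exact (sEw t ht).tsum_le_of_sum_le h1
  -- `y` is a supremum of continuous finite sums, hence lower semicontinuous, which is enough for
  -- closedness.
  have hclosed : IsClosed ({t | y t ≤ y₀ + P t} ∩ Icc 0 R) := by
    have h1 : {t | y t ≤ y₀ + P t} ∩ Icc 0 R = ⋂ A : Finset ι, Icc 0 R ∩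
        {t | ∑ i ∈ A, Real.exp (τ t * φ i) * w i t - P t ∈ Iic y₀} := by
      ext t
      simp only [mem_inter_iff, mem_ofPred_eq, mem_iInter, mem_Iic]
      constructor
      · rintro ⟨h1, ht⟩ A
        refine ⟨ht, ?_⟩
        have h3 := (sEw t ht).sum_le_tsum A fun i _ => nEw t ht i
        simp only [y] at h1
        linarith
      · intro hA
        have ht := (hA ∅).1
        refine ⟨(sEw t ht).tsum_le_of_sum_le fun A => ?_, ht⟩
        have := (hA A).2
        linarith
    rw [h1]
    refine isClosed_iInter fun A => ?_
    refine ContinuousOn.preimage_isClosed_of_isClosed ?_ isClosed_Icc isClosed_Iic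
    refine ContinuousOn.sub (continuousOn_finsetSum A fun i _ => ?_) hPc
    have c1 := h.cont_w i
    have c2 := h.cont_τ
    fun_prop
  refine hclosed.Icc_subset_of_forall_exists_gt ?_ ?_ ht₁
  · simpa [y, P] using hy₀
  · rintro x ⟨hx, hx1⟩ z hz
    simp only [mem_ofPred_eq] at hx
    have hxR : x ∈ Icc 0 R := Ico_subset_Icc_self hx1
    have hPx := hPc x hxR
    have hev : ∀ᶠ r in 𝓝[Icc 0 R] x, C * (P r - P x) < 1 / 2 := by
      have h1 : Tendsto (fun r => C * (P r - P x)) (𝓝[Icc 0 R] x) (𝓝 (C * (P x - P x))) :=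
        (hPx.tendsto.sub_const (P x)).const_mul C
      rw [sub_self, mul_zero] at h1
      exact h1.eventually_lt_const (by norm_num)
    obtain ⟨δ, hδ, hball⟩ := Metric.mem_nhdsWithin_iff.1 hev
    set t := min (min z R) (x + δ / 2)
    have hxt : x < t := lt_min (lt_min hz hx1.2) (by linarith)
    have htz : t ≤ z := (min_le_left _ _).trans (min_le_left _ _)
    have htR : t ≤ R := (min_le_left _ _).trans (min_le_right _ _)
    have htδ : t ≤ x + δ / 2 := min_le_right _ _
    have ht : t ∈ Icc 0 R := ⟨hxR.1.trans hxt.le, htR⟩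
    refine ⟨t, ?_, hxt, htz⟩
    -- On the short interval `[x, t]` the crude bound lets `y` grow by less than `1/2`, so the
    -- absorption hypothesis is available there.
    have h2 := h.tsum_le_of_absorbed hsrc hN hC hexp hw hW hF hFsrc hxR ht hxt.le
      (fun r hr => ?_)
    · have h3 := hPadd x hxR t ht hxt.le
      simp only [mem_ofPred_eq]
      change y t ≤ y x + _ at h2
      linarith
    · have hr' : r ∈ Icc 0 R := ⟨hxR.1.trans hr.1, hr.2.trans htR⟩
      refine habs r hr' ?_
      have h4 := hcrude x hxR r hr' hr.1
      have h5 : C * (P r - P x) < 1 / 2 := hball ⟨by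
        rw [Metric.mem_ball, Real.dist_eq, abs_of_nonneg (by linarith [hr.1])]
        linarith [hr.2], hr'⟩
      have h6 : P x ≤ P r := by
        rw [← hPadd x hxR r hr' hr.1]
        have := intervalIntegral.integral_nonneg (μ := volume) hr.1 fun q hq =>
          hsrc0 q ⟨hxR.1.trans hq.1, hq.2.trans hr'.2⟩
        linarith
      change y r ≤ _
      change _ ≤ y₀ + P r + 1 / 2
      linarith

end WeightedModes

end WaveGevrey

/-! ### Truncated weights and mode energies -/

namespace WaveGevrey

variable {n : ℕ}

lemma partNorm_eq_norm (m : ℕ) (j : Fin n → ℤ) :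
    partNorm m j =
      ‖WithLp.toLp 2 (fun i : Fin n => if (i : ℕ) < m then (j i : ℝ) else 0)‖ := by
  rw [EuclideanSpace.norm_eq, partNorm]
  congr 1
  refine Finset.sum_congr rfl fun i _ => ?_
  by_cases h : (i : ℕ) < m <;> simp [h]

lemma partNorm_nonneg (m : ℕ) (j : Fin n → ℤ) : 0 ≤ partNorm m j := Real.sqrt_nonneg _

lemma partNorm_zero (m : ℕ) : partNorm m (0 : Fin n → ℤ) = 0 := by simp [partNorm]

lemma partNorm_add_le (m : ℕ) (j l : Fin n → ℤ) :
    partNorm m (j + l) ≤ partNorm m j + partNorm m l := by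
  simp only [partNorm_eq_norm]
  refine le_trans (le_of_eq ?_) (norm_add_le _ _)
  congr 1
  ext i
  by_cases h : (i : ℕ) < m <;> simp [h]

lemma partNorm_sq_le (m : ℕ) (j : Fin n → ℤ) : partNorm m j ^ 2 ≤ bracketSq j := by
  rw [partNorm, Real.sq_sqrt (Finset.sum_nonneg fun i _ => by split_ifs <;> positivity)]
  refine le_trans (Finset.sum_le_sum fun i _ => ?_) (le_add_of_nonneg_left zero_le_one)
  split_ifs
  · exact le_rfl
  · positivity

/-- The truncation `min(|j'|, N)`. -/
noncomputable def truncNorm (m N : ℕ) (j : Fin n → ℤ) : ℝ := min (partNorm m j) N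

lemma truncNorm_nonneg (m N : ℕ) (j : Fin n → ℤ) : 0 ≤ truncNorm m N j :=
  le_min (partNorm_nonneg m j) N.cast_nonneg

lemma truncNorm_le (m N : ℕ) (j : Fin n → ℤ) : truncNorm m N j ≤ partNorm m j := min_le_left _ _

/-- Truncation preserves subadditivity: once one summand reaches `N`, the right-hand side is already
at least `N`. -/
lemma truncNorm_add_le (m N : ℕ) (j l : Fin n → ℤ) :
    truncNorm m N (j + l) ≤ truncNorm m N j + truncNorm m N l := by
  have h1 := partNorm_add_le m j l
  have h2 := truncNorm_nonneg m N j
  have h3 := truncNorm_nonneg m N l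
  unfold truncNorm at *
  rcases le_total (partNorm m j) N with hj | hj <;> rcases le_total (partNorm m l) N with hl | hl
  · rw [min_eq_left hj, min_eq_left hl]; exact (min_le_left _ _).trans h1
  · rw [min_eq_right hl]; exact (min_le_right _ _).trans (by linarith)
  · rw [min_eq_right hj]; exact (min_le_right _ _).trans (by linarith)
  · rw [min_eq_right hj]; exact (min_le_right _ _).trans (by linarith)

lemma isSubmulWeight_exp (m N : ℕ) {τ : ℝ} (hτ : 0 ≤ τ) :
    IsSubmulWeight fun j : Fin n → ℤ => Real.exp (τ * truncNorm m N j) where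
  one_le j := Real.one_le_exp (mul_nonneg hτ (truncNorm_nonneg m N j))
  zero := by simp [truncNorm, partNorm_zero]
  add_le j l := by
    rw [← Real.exp_add, ← mul_add]
    exact Real.exp_le_exp.2 (mul_le_mul_of_nonneg_left (truncNorm_add_le m N j l) hτ)

lemma isSubmulWeight_one : IsSubmulWeight fun _ : Fin n → ℤ => (1 : ℝ) where
  one_le _ := le_rfl
  zero := rfl
  add_le _ _ := by norm_num

/-- The first term suffices for `x ≤ 1`, the second for `x ≥ 1`. With `x = τφ` the second term
produces the factor `τ²` of the equation for `τ`. -/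
lemma exp_le_exp_one_add (x : ℝ) : Real.exp x ≤ Real.exp 1 + x ^ 2 * Real.exp x := by
  have h := Real.exp_pos x
  rcases le_total x 1 with h1 | h1
  · have h2 := Real.exp_le_exp.2 h1
    have h3 : 0 ≤ x ^ 2 * Real.exp x := by positivity
    linarith
  · have h2 : 1 ≤ x ^ 2 := one_le_pow₀ h1
    have h3 := Real.exp_pos 1
    nlinarith

/-- The energy `(|v_j|² + (1+|j|²) |u_j|²)^{1/2}` of one mode. -/
noncomputable def modeEnergy (c d : Coeffs n) (j : Fin n → ℤ) : ℝ :=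
  Real.sqrt (‖d j‖ ^ 2 + bracketSq j * ‖c j‖ ^ 2)

lemma modeEnergy_nonneg (c d : Coeffs n) (j : Fin n → ℤ) : 0 ≤ modeEnergy c d j :=
  Real.sqrt_nonneg _

lemma norm_opA (c : Coeffs n) (j : Fin n → ℤ) : ‖opA c j‖ = Real.sqrt (bracketSq j) * ‖c j‖ := by
  simp [opA, abs_of_nonneg (Real.sqrt_nonneg _)]

lemma norm_opA_sq (c : Coeffs n) (j : Fin n → ℤ) : ‖opA c j‖ ^ 2 = bracketSq j * ‖c j‖ ^ 2 := by
  rw [norm_opA, mul_pow, Real.sq_sqrt (bracketSq_pos j).le]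

lemma norm_opA_le_modeEnergy (c d : Coeffs n) (j : Fin n → ℤ) : ‖opA c j‖ ≤ modeEnergy c d j := by
  refine Real.le_sqrt_of_sq_le ?_
  rw [norm_opA_sq]
  exact le_add_of_nonneg_left (sq_nonneg _)

lemma norm_le_modeEnergy (c d : Coeffs n) (j : Fin n → ℤ) : ‖d j‖ ≤ modeEnergy c d j :=
  Real.le_sqrt_of_sq_le
    (le_add_of_nonneg_right (mul_nonneg (bracketSq_pos j).le (sq_nonneg _)))

lemma modeEnergy_le (c d : Coeffs n) (j : Fin n → ℤ) : modeEnergy c d j ≤ ‖opA c j‖ + ‖d j‖ := by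
  refine Real.sqrt_le_iff.2 ⟨by positivity, ?_⟩
  rw [← norm_opA_sq]
  nlinarith [norm_nonneg (opA c j), norm_nonneg (d j)]

lemma norm_coeff_le_modeEnergy (c d : Coeffs n) (j : Fin n → ℤ) : ‖c j‖ ≤ modeEnergy c d j := by
  refine le_trans ?_ (norm_opA_le_modeEnergy c d j)
  rw [norm_opA]
  exact le_mul_of_one_le_left (norm_nonneg _) (Real.one_le_sqrt.2 (one_le_bracketSq j))

/-- The energy carries one derivative more than `u`; this pays for one of the two factors `φ` in
`(τφ)² e^{τφ} |u_j|`. -/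
lemma partNorm_mul_le_modeEnergy (m : ℕ) (c d : Coeffs n) (j : Fin n → ℤ) :
    partNorm m j * ‖c j‖ ≤ modeEnergy c d j := by
  refine le_trans ?_ (norm_opA_le_modeEnergy c d j)
  rw [norm_opA]
  exact mul_le_mul_of_nonneg_right (Real.le_sqrt_of_sq_le (partNorm_sq_le m j)) (norm_nonneg _)

/-- Unweighted summability is required separately: for `τ < 0` it does not follow from the weighted
one, and it supplies the integrable function. -/
lemma MemGevrey.of_modeEnergy {m : ℕ} {τ : ℝ} {e : Coeffs n} {w : (Fin n → ℤ) → ℝ}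
    (hw : Summable w) (hτ : Summable fun j => Real.exp (τ * partNorm m j) * w j)
    (hle : ∀ j, ‖e j‖ ≤ w j) : MemGevrey m τ e :=
  ⟨exists_integrable_hat_eq (hw.of_nonneg_of_le (fun _ => norm_nonneg _) hle),
    hτ.of_nonneg_of_le (fun _ => mul_nonneg (Real.exp_pos _).le (norm_nonneg _))
      fun j => mul_le_mul_of_nonneg_left (hle j) (Real.exp_pos _).le⟩

lemma summable_initialEnergy {m : ℕ} {σ τ₀ : ℝ} (hτ : τ₀ ≤ σ) {c d : Coeffs n}
    (hc : MemGevrey m σ (opA c)) (hd : MemGevrey m σ d) :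
    Summable fun j => Real.exp (τ₀ * partNorm m j) * modeEnergy c d j := by
  refine (hc.2.add hd.2).of_nonneg_of_le
    (fun j => mul_nonneg (Real.exp_pos _).le (modeEnergy_nonneg _ _ _)) fun j => ?_
  rw [← mul_add]
  exact mul_le_mul (Real.exp_le_exp.2 (mul_le_mul_of_nonneg_right hτ (partNorm_nonneg m j)))
    (modeEnergy_le c d j) (modeEnergy_nonneg _ _ _) (Real.exp_pos _).le

/-! ### Energy estimates for the solution -/

section Solution

variable {m : ℕ} {p lam T : ℝ} {a : (Fin n → ℤ) → ℕ → ℝ → ℂ} {u₀ u₁ : L2 n} {u ut : ℝ → L2 n}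
  {utt : ℝ → Coeffs n}

lemma IsSolution.weightedModes (h : IsSolution p T a u₀ u₁ u ut utt) {R : ℝ} (hR : R ≤ T)
    {φ : (Fin n → ℤ) → ℝ} (hφ : ∀ j, 0 ≤ φ j) {τ τ' : ℝ → ℝ}
    (hτ : ∀ t ∈ Icc 0 R, HasDerivWithinAt τ (τ' t) (Icc 0 R) t)
    (hτ0 : ∀ t ∈ Icc 0 R, τ' t ≤ 0) (hτi : IntegrableOn τ' (Icc 0 R)) :
    WeightedModes R φ (fun j t => modeEnergy (hat (u t)) (hat (ut t)) j)
      (fun j t => ‖utt t j + bracketSq j * hat (u t) j‖) τ τ' := by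
  have hsub : Icc 0 R ⊆ Icc 0 T := Icc_subset_Icc_right hR
  have cu := fun j => (h.cont.continuousOn_apply j).mono hsub
  have cut := fun j => (h.cont_t.continuousOn_apply j).mono hsub
  have cutt := fun j => (h.cont_tt.continuousOn_apply j).mono hsub
  refine ⟨fun j => ?_, fun j => ?_, fun t ht => (hτ t ht).continuousWithinAt, hτi, hτ0,
    fun j t _ => modeEnergy_nonneg _ _ _, fun j t _ => norm_nonneg _, hφ, ?_⟩
  · have := continuousOn_sqrt_energy (b := bracketSq j) (cu j) (cut j) 0
    simp only [add_zero] at this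
    exact this
  · have h1 := cu j
    have h2 := cutt j
    fun_prop
  · intro j s hs t ht hst
    have hst' : Icc s t ⊆ Icc 0 R := Icc_subset_Icc hs.1 ht.2
    refine exp_mul_sqrt_energy_le hst (bracketSq_pos j).le (hφ j)
      (x := fun r => hat (u r) j) (y := fun r => hat (ut r) j) (z := fun r => utt r j)
      (fun r hr => ?_) (fun r hr => ?_) ((cutt j).mono hst')
      (fun r hr => (hτ r (hst' hr)).mono hst') (fun r hr => hτ0 r (hst' hr)) (hτi.mono_set hst')
    · exact (h.deriv_t.hasDerivWithinAt_apply (fun t ht => (h.cont.1 t ht).mono (by linarith))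
        h.cont_t.1 j (hsub (hst' hr))).mono (hst'.trans hsub)
    · exact (h.deriv_tt.hasDerivWithinAt_apply (fun t ht => (h.cont_t.1 t ht).mono (by linarith))
        h.cont_tt.1 j (hsub (hst' hr))).mono (hst'.trans hsub)

/-- This is the algebra estimate for the weight `1`; monotonicity of `g` then inserts the factor `2e
≥ 1`. -/
lemma IsSolution.forcing_le_source (hn : 1 ≤ n) (hp : (n : ℝ) / 2 < p) (hp0 : 0 ≤ p)
    (hlam : 0 ≤ lam) (ha : Majorized m p lam T a) (h : IsSolution p T a u₀ u₁ u ut utt) {t : ℝ}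
    (ht : t ∈ Icc 0 T) :
    (Summable fun j => ‖utt t j + bracketSq j * hat (u t) j‖) ∧
      ∑' j, ‖utt t j + bracketSq j * hat (u t) j‖ ≤ source m p lam a u t := by
  have hs := (h.cont.1 t ht).summable_norm hn hp
  have h1 := h.weighted_nonlin_le hn hp hp0 ha ht isSubmulWeight_one
    (fun j => Real.one_le_exp (mul_nonneg hlam (partNorm_nonneg m j)))
    (by simpa only [one_mul] using hs)
  simp only [one_mul] at h1
  refine ⟨h1.1, h1.2.trans ?_⟩
  have h2 : 0 ≤ ∑' j, ‖hat (u t) j‖ := tsum_nonneg fun _ => norm_nonneg _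
  refine ha.majorant_mono ht h2 ?_
  refine le_mul_of_one_le_left h2 ?_
  have := Real.add_one_le_exp 1
  linarith

lemma source_nonneg (t : ℝ) : 0 ≤ source m p lam a u t :=
  majorant_nonneg (mul_nonneg (by positivity) (tsum_nonneg fun _ => norm_nonneg _))

lemma initialEnergy_nonneg {τ₀ : ℝ} : 0 ≤ initialEnergy m τ₀ u₀ u₁ :=
  tsum_nonneg fun _ => mul_nonneg (Real.exp_pos _).le (Real.sqrt_nonneg _)

/-- The energy inequality with weight exponent `0`, where nothing has to be absorbed. It gives the a
priori finiteness on which all truncated sums rest. -/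
lemma IsSolution.summable_modeEnergy (hn : 1 ≤ n) (hp : (n : ℝ) / 2 < p) (hp0 : 0 ≤ p)
    (hlam : 0 ≤ lam) (ha : Majorized m p lam T a) (h : IsSolution p T a u₀ u₁ u ut utt)
    (hint : IntegrableOn (source m p lam a u) (Icc 0 T)) {y₀ : ℝ}
    (h0 : Summable (modeEnergy (hat u₀) (hat u₁)))
    (hy₀ : ∑' j, modeEnergy (hat u₀) (hat u₁) j ≤ y₀) {t : ℝ} (ht : t ∈ Icc 0 T) :
    Summable (modeEnergy (hat (u t)) (hat (ut t))) ∧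
      ∑' j, modeEnergy (hat (u t)) (hat (ut t)) j ≤
        y₀ + ∫ s in (0 : ℝ)..t, source m p lam a u s := by
  have hw := h.weightedModes le_rfl (φ := fun _ => 0) (fun _ => le_rfl) (τ := fun _ => 0)
    (τ' := fun _ => 0) (fun t _ => hasDerivWithinAt_const _ _ _) (fun _ _ => le_rfl)
    integrableOn_zero
  have h00 : (0 : ℝ) ∈ Icc 0 T := ⟨le_rfl, ht.1.trans ht.2⟩
  have key : ∀ A : Finset (Fin n → ℤ), ∑ j ∈ A, modeEnergy (hat (u t)) (hat (ut t)) j ≤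
      y₀ + ∫ s in (0 : ℝ)..t, source m p lam a u s := by
    intro A
    have h1 := hw.sum_le_of_forcing_le hint h00 ht ht.1 (fun r hr A => ?_) A
    · simp only [mul_zero, Real.exp_zero, one_mul, h.init, h.init_t] at h1
      have h2 := h0.sum_le_tsum A fun j _ => modeEnergy_nonneg _ _ j
      linarith
    · have h3 := h.forcing_le_source hn hp hp0 hlam ha (t := r) ⟨hr.1, hr.2.trans ht.2⟩
      simp only [mul_zero, Real.exp_zero, one_mul]
      exact (h3.1.sum_le_tsum A fun _ _ => norm_nonneg _).trans h3.2
  have hs := summable_of_sum_le (fun j => modeEnergy_nonneg (hat (u t)) (hat (ut t)) j) key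
  exact ⟨hs, hs.tsum_le_of_sum_le key⟩

/-- Part of the weighted nonlinear term is absorbed by the loss of radius of analyticity. -/
lemma IsSolution.weighted_forcing_le (hn : 1 ≤ n) (hp : (n : ℝ) / 2 < p) (hp0 : 0 ≤ p)
    (ha : Majorized m p lam T a) (h : IsSolution p T a u₀ u₁ u ut utt) {t : ℝ}
    (ht : t ∈ Icc 0 T) (hw : Summable (modeEnergy (hat (u t)) (hat (ut t)))) {τ Y : ℝ}
    (hτ : 0 ≤ τ) (hτl : τ ≤ lam) (N : ℕ) (hY : 0 ≤ Y)
    (hle : ∑' j, Real.exp (τ * truncNorm m N j) * modeEnergy (hat (u t)) (hat (ut t)) j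
      ≤ Y + 1 / 2) :
    ∑' j, Real.exp (τ * truncNorm m N j) * ‖utt t j + bracketSq j * hat (u t) j‖ ≤
      source m p lam a u t + τ ^ 2 * majorant m p lam a t (2 * Y + 1) *
        ∑' j, truncNorm m N j * (Real.exp (τ * truncNorm m N j) *
          modeEnergy (hat (u t)) (hat (ut t)) j) := by
  set w := modeEnergy (hat (u t)) (hat (ut t))
  set φ : (Fin n → ℤ) → ℝ := truncNorm m N
  have hω := isSubmulWeight_exp (n := n) m N hτ
  have hsn := (h.cont.1 t ht).summable_norm hn hp
  have hw0 : ∀ j, 0 ≤ w j := modeEnergy_nonneg _ _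
  have hφ0 : ∀ j, 0 ≤ φ j := truncNorm_nonneg m N
  have hφN : ∀ j, φ j ≤ N := fun j => min_le_right _ _
  have hexp : ∀ j, Real.exp (τ * φ j) ≤ Real.exp (τ * N) := fun j =>
    Real.exp_le_exp.2 (mul_le_mul_of_nonneg_left (hφN j) hτ)
  have sEw : Summable fun j => Real.exp (τ * φ j) * w j :=
    (hw.mul_left (Real.exp (τ * N))).of_nonneg_of_le
      (fun j => mul_nonneg (Real.exp_pos _).le (hw0 j))
      fun j => mul_le_mul_of_nonneg_right (hexp j) (hw0 j)
  have sφ : Summable fun j => φ j * (Real.exp (τ * φ j) * w j) :=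
    (sEw.mul_left (N : ℝ)).of_nonneg_of_le
      (fun j => mul_nonneg (hφ0 j) (mul_nonneg (Real.exp_pos _).le (hw0 j)))
      fun j => mul_le_mul_of_nonneg_right (hφN j) (mul_nonneg (Real.exp_pos _).le (hw0 j))
  have hcw : ∀ j, Real.exp (τ * φ j) * ‖hat (u t) j‖ ≤ Real.exp (τ * φ j) * w j := fun j =>
    mul_le_mul_of_nonneg_left (norm_coeff_le_modeEnergy _ _ j) (Real.exp_pos _).le
  have sEc : Summable fun j => Real.exp (τ * φ j) * ‖hat (u t) j‖ :=
    sEw.of_nonneg_of_le (fun j => mul_nonneg (Real.exp_pos _).le (norm_nonneg _)) hcw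
  have h1 := h.weighted_nonlin_le hn hp hp0 ha ht hω (fun j => Real.exp_le_exp.2
    (mul_le_mul hτl (truncNorm_le m N j) (hφ0 j) (hτ.trans hτl))) sEc
  refine h1.2.trans ?_
  have hS0 : 0 ≤ ∑' j, Real.exp (τ * φ j) * ‖hat (u t) j‖ :=
    tsum_nonneg fun j => mul_nonneg (Real.exp_pos _).le (norm_nonneg _)
  have hb0 : 0 ≤ ∑' j, φ j * (Real.exp (τ * φ j) * w j) :=
    tsum_nonneg fun j => mul_nonneg (hφ0 j) (mul_nonneg (Real.exp_pos _).le (hw0 j))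
  have hSY : ∑' j, Real.exp (τ * φ j) * ‖hat (u t) j‖ ≤ Y + 1 / 2 :=
    (sEc.tsum_le_tsum hcw sEw).trans hle
  -- Of the factor `φ²` from `exp_le_exp_one_add`, one `φ` turns `|u_j|` into the mode energy and
  -- the other remains in the sum.
  have hSab : ∑' j, Real.exp (τ * φ j) * ‖hat (u t) j‖ ≤ Real.exp 1 * normL1 (hat (u t)) +
      τ ^ 2 * ∑' j, φ j * (Real.exp (τ * φ j) * w j) := by
    rw [normL1, ← tsum_mul_left, ← tsum_mul_left,
      ← (hsn.mul_left (Real.exp 1)).tsum_add (sφ.mul_left (τ ^ 2))]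
    refine sEc.tsum_le_tsum (fun j => ?_)
      ((hsn.mul_left (Real.exp 1)).add (sφ.mul_left (τ ^ 2)))
    have h2 := mul_le_mul_of_nonneg_right (exp_le_exp_one_add (τ * φ j))
      (norm_nonneg (hat (u t) j))
    have h3 : φ j * ‖hat (u t) j‖ ≤ w j :=
      (mul_le_mul_of_nonneg_right (truncNorm_le m N j) (norm_nonneg _)).trans
        (partNorm_mul_le_modeEnergy m _ _ j)
    have h4 : 0 ≤ τ ^ 2 * φ j * Real.exp (τ * φ j) :=
      mul_nonneg (mul_nonneg (sq_nonneg _) (hφ0 j)) (Real.exp_pos _).le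
    have h5 := mul_le_mul_of_nonneg_left h3 h4
    linarith
  -- `R = 2Y + 1` is twice the bound `Y + 1/2`, and `2α` is the argument of `g` in `source`.
  have h6 := ha.majorant_le_add ht (R := 2 * Y + 1) (α := Real.exp 1 * normL1 (hat (u t))) hS0
    (mul_nonneg (Real.exp_pos 1).le (tsum_nonneg fun j => norm_nonneg (hat (u t) j)))
    (mul_nonneg (sq_nonneg τ) hb0) hSab (by linarith) (by linarith)
  rw [← mul_assoc] at h6
  refine h6.trans (le_of_eq ?_)
  rw [source]
  ring

/-- Propagation of the weighted energy with the truncated weight. -/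
lemma IsSolution.tsum_truncated_le (hn : 1 ≤ n) (hp : (n : ℝ) / 2 < p) (hp0 : 0 ≤ p)
    (ha : Majorized m p lam T a) (h : IsSolution p T a u₀ u₁ u ut utt)
    (hint : IntegrableOn (source m p lam a u) (Icc 0 T)) {τ₀ : ℝ} (hτ₀ : 0 ≤ τ₀)
    (hτ₀l : τ₀ ≤ lam)
    (h0 : Summable fun j => Real.exp (τ₀ * partNorm m j) * modeEnergy (hat u₀) (hat u₁) j)
    {R : ℝ} (hR0 : 0 ≤ R) (hR : R ≤ T) {τ : ℝ → ℝ} (hτz : τ 0 = τ₀)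
    (hτ : ∀ t ∈ Icc 0 R, HasDerivWithinAt τ
      (-(τ t) ^ 2 * hTilde m p lam τ₀ a u₀ u₁ u t) (Icc 0 R) t)
    (hτ' : ∀ t ∈ Icc 0 R, -(τ t) ^ 2 * hTilde m p lam τ₀ a u₀ u₁ u t ≤ 0)
    (hτi : IntegrableOn (fun t => -(τ t) ^ 2 * hTilde m p lam τ₀ a u₀ u₁ u t) (Icc 0 R))
    (hτm : ∀ t ∈ Icc 0 R, τ t ≤ τ₀) (hτpos : ∀ t ∈ Icc 0 R, 0 ≤ τ t) (N : ℕ) :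
    ∑' j, Real.exp (τ R * truncNorm m N j) * modeEnergy (hat (u R)) (hat (ut R)) j ≤
      initialEnergy m τ₀ u₀ u₁ + ∫ s in (0 : ℝ)..R, source m p lam a u s := by
  have hsub : Icc 0 R ⊆ Icc 0 T := Icc_subset_Icc_right hR
  have hlam := hτ₀.trans hτ₀l
  have hy0 := initialEnergy_nonneg (m := m) (τ₀ := τ₀) (u₀ := u₀) (u₁ := u₁)
  have hone : ∀ j, modeEnergy (hat u₀) (hat u₁) j ≤
      Real.exp (τ₀ * partNorm m j) * modeEnergy (hat u₀) (hat u₁) j := fun j =>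
    le_mul_of_one_le_left (modeEnergy_nonneg _ _ j)
      (Real.one_le_exp (mul_nonneg hτ₀ (partNorm_nonneg m j)))
  have hw0 : Summable (modeEnergy (hat u₀) (hat u₁)) :=
    h0.of_nonneg_of_le (modeEnergy_nonneg _ _) hone
  have hP0 : ∀ t ∈ Icc 0 R, 0 ≤ ∫ s in (0 : ℝ)..t, source m p lam a u s := fun t ht =>
    intervalIntegral.integral_nonneg ht.1 fun s _ => source_nonneg s
  have hw : ∀ t ∈ Icc 0 R, Summable (modeEnergy (hat (u t)) (hat (ut t))) ∧
      ∑' j, modeEnergy (hat (u t)) (hat (ut t)) j ≤ initialEnergy m τ₀ u₀ u₁ +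
        ∫ s in (0 : ℝ)..t, source m p lam a u s := fun t ht =>
    h.summable_modeEnergy hn hp hp0 hlam ha hint hw0 (hw0.tsum_le_tsum hone h0) (hsub ht)
  have hmono : ∀ t ∈ Icc 0 R, ∫ s in (0 : ℝ)..t, source m p lam a u s ≤
      ∫ s in (0 : ℝ)..R, source m p lam a u s := fun t ht =>
    intervalIntegral.integral_mono_interval le_rfl ht.1 ht.2
      (Eventually.of_forall fun s => source_nonneg s)
      (WeightedModes.intervalIntegrable_of_integrableOn hint ⟨le_rfl, hR0.trans hR⟩ ⟨hR0, hR⟩ hR0)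
  have hexp : ∀ t ∈ Icc 0 R, ∀ j : Fin n → ℤ,
      Real.exp (τ t * truncNorm m N j) ≤ Real.exp (τ₀ * N) := fun t ht j =>
    Real.exp_le_exp.2 (mul_le_mul (hτm t ht) (min_le_right _ _) (truncNorm_nonneg m N j) hτ₀)
  have hM := h.weightedModes hR (truncNorm_nonneg m N) hτ hτ' hτi
  -- The constant `C = e^{τ₀N}` depends on `N`, but it only controls the step length of the
  -- induction, not the resulting bound.
  refine hM.tsum_le_of_bootstrap (hint.mono_set hsub) (N := N) (fun j => min_le_right _ _)
    (Real.exp_pos (τ₀ * N)).le hexp (fun t ht => (hw t ht).1)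
    (fun t ht => (hw t ht).2.trans (add_le_add_right (hmono t ht) _))
    (fun t ht => (h.forcing_le_source hn hp hp0 hlam ha (hsub ht)).1)
    (fun t ht => (h.forcing_le_source hn hp hp0 hlam ha (hsub ht)).2) ?_ ?_ R ⟨hR0, le_rfl⟩
  · rw [hτz, h.init, h.init_t]
    have hle : ∀ j : Fin n → ℤ,
        Real.exp (τ₀ * truncNorm m N j) * modeEnergy (hat u₀) (hat u₁) j ≤
          Real.exp (τ₀ * partNorm m j) * modeEnergy (hat u₀) (hat u₁) j := fun j =>
      mul_le_mul_of_nonneg_right (Real.exp_le_exp.2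
        (mul_le_mul_of_nonneg_left (truncNorm_le m N j) hτ₀)) (modeEnergy_nonneg _ _ j)
    exact (h0.of_nonneg_of_le
      (fun j => mul_nonneg (Real.exp_pos _).le (modeEnergy_nonneg _ _ j)) hle).tsum_le_tsum hle h0
  · intro r hr hle
    refine (h.weighted_forcing_le hn hp hp0 ha (hsub hr) (hw r hr).1 (hτpos r hr)
      ((hτm r hr).trans hτ₀l) N (add_nonneg hy0 (hP0 r hr)) hle).trans (le_of_eq ?_)
    -- With `Y` the current energy bound, `2Y + 1` is the argument of `g` in `h̃`, so the extra
    -- forcing equals the loss term.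
    rw [hTilde, mul_add]
    ring

/-- Propagation of the weighted energy: the weight `e^{τ(t)|j'|}`. -/
lemma IsSolution.summable_exp_mul_modeEnergy (hn : 1 ≤ n) (hp : (n : ℝ) / 2 < p) (hp0 : 0 ≤ p)
    (ha : Majorized m p lam T a) (h : IsSolution p T a u₀ u₁ u ut utt)
    (hint : IntegrableOn (source m p lam a u) (Icc 0 T)) {τ₀ : ℝ} (hτ₀ : 0 ≤ τ₀)
    (hτ₀l : τ₀ ≤ lam)
    (h0 : Summable fun j => Real.exp (τ₀ * partNorm m j) * modeEnergy (hat u₀) (hat u₁) j)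
    {τ : ℝ → ℝ} (hτz : τ 0 = τ₀)
    (hτ : ∀ t ∈ Icc 0 T, HasDerivWithinAt τ
      (-(τ t) ^ 2 * hTilde m p lam τ₀ a u₀ u₁ u t) (Icc 0 T) t) {t : ℝ} (ht : t ∈ Icc 0 T) :
    Summable (modeEnergy (hat (u t)) (hat (ut t))) ∧ Summable fun j =>
      Real.exp (τ t * partNorm m j) * modeEnergy (hat (u t)) (hat (ut t)) j := by
  have hT : (0 : ℝ) ≤ T := ht.1.trans ht.2
  have hone : ∀ j, modeEnergy (hat u₀) (hat u₁) j ≤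
      Real.exp (τ₀ * partNorm m j) * modeEnergy (hat u₀) (hat u₁) j := fun j =>
    le_mul_of_one_le_left (modeEnergy_nonneg _ _ j)
      (Real.one_le_exp (mul_nonneg hτ₀ (partNorm_nonneg m j)))
  have hw0 : Summable (modeEnergy (hat u₀) (hat u₁)) :=
    h0.of_nonneg_of_le (modeEnergy_nonneg _ _) hone
  have hwt := (h.summable_modeEnergy hn hp hp0 (hτ₀.trans hτ₀l) ha hint hw0 le_rfl ht).1
  refine ⟨hwt, ?_⟩
  -- Positivity of `τ` is not assumed; where `τ t ≤ 0` the weight is at most `1`.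
  rcases le_or_gt (τ t) 0 with hneg | hpos
  · refine hwt.of_nonneg_of_le
      (fun j => mul_nonneg (Real.exp_pos _).le (modeEnergy_nonneg _ _ j)) fun j => ?_
    exact mul_le_of_le_one_left (modeEnergy_nonneg _ _ j)
      (Real.exp_le_one_iff.2 (mul_nonpos_of_nonpos_of_nonneg hneg (partNorm_nonneg m j)))
  have hcont : ContinuousOn τ (Icc 0 T) := fun r hr => (hτ r hr).continuousWithinAt
  have hy0 := initialEnergy_nonneg (m := m) (τ₀ := τ₀) (u₀ := u₀) (u₁ := u₁)
  have hτ' : ∀ r ∈ Icc 0 T, -(τ r) ^ 2 * hTilde m p lam τ₀ a u₀ u₁ u r ≤ 0 := by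
    intro r hr
    refine mul_nonpos_of_nonpos_of_nonneg (neg_nonpos.2 (sq_nonneg _)) (majorant_nonneg ?_)
    have := intervalIntegral.integral_nonneg (μ := volume) hr.1 fun s _ =>
      source_nonneg (m := m) (p := p) (lam := lam) (a := a) (u := u) s
    linarith
  have hderiv : ∀ r ∈ Ioo 0 T, HasDerivAt τ (-(τ r) ^ 2 * hTilde m p lam τ₀ a u₀ u₁ u r) r :=
    fun r hr => (hτ r (Ioo_subset_Icc_self hr)).hasDerivAt (Icc_mem_nhds hr.1 hr.2)
  have hanti : AntitoneOn τ (Icc 0 T) := by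
    refine antitoneOn_of_hasDerivWithinAt_nonpos (convex_Icc 0 T) hcont
      (f' := fun r => -(τ r) ^ 2 * hTilde m p lam τ₀ a u₀ u₁ u r) ?_ ?_
    · rw [interior_Icc]
      exact fun r hr => (hderiv r hr).hasDerivWithinAt
    · rw [interior_Icc]
      exact fun r hr => hτ' r (Ioo_subset_Icc_self hr)
  -- No integrability of `h̃` is given: `τ'` is integrable because it has constant sign and `τ` is
  -- continuous.
  have hτi : IntegrableOn (fun r => -(τ r) ^ 2 * hTilde m p lam τ₀ a u₀ u₁ u r) (Icc 0 T) := by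
    rw [integrableOn_Icc_iff_integrableOn_Ioc]
    have h1 := intervalIntegral.integrableOn_deriv_of_nonneg hcont.neg
      (fun r hr => (hderiv r hr).neg)
      fun r hr => neg_nonneg.2 (hτ' r (Ioo_subset_Icc_self hr))
    simpa using h1.neg
  have hsub : Icc 0 t ⊆ Icc 0 T := Icc_subset_Icc_right ht.2
  -- Applied on `[0, t]`, where monotonicity gives `τ ≥ τ t > 0`.
  have key := h.tsum_truncated_le hn hp hp0 ha hint hτ₀ hτ₀l h0 ht.1 ht.2 hτz
    (fun r hr => (hτ r (hsub hr)).mono hsub) (fun r hr => hτ' r (hsub hr)) (hτi.mono_set hsub)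
    (fun r hr => hτz ▸ hanti ⟨le_rfl, hT⟩ (hsub hr) hr.1)
    (fun r hr => hpos.le.trans (hanti (hsub hr) ht hr.2))
  refine summable_of_sum_le (c := initialEnergy m τ₀ u₀ u₁ +
      ∫ s in (0 : ℝ)..t, source m p lam a u s)
    (fun j => mul_nonneg (Real.exp_pos _).le (modeEnergy_nonneg _ _ j)) fun A => ?_
  -- For a finite set of modes a large `N` makes the truncation inactive, while the bound is uniform
  -- in `N`.
  obtain ⟨N, hN⟩ := exists_nat_ge (∑ j ∈ A, partNorm m j)
  have htr : ∀ j ∈ A, truncNorm m N j = partNorm m j := fun j hj =>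
    min_eq_left ((Finset.single_le_sum (fun l _ => partNorm_nonneg m l) hj).trans hN)
  have hs : Summable fun j : Fin n → ℤ => Real.exp (τ t * truncNorm m N j) *
      modeEnergy (hat (u t)) (hat (ut t)) j :=
    (hwt.mul_left (Real.exp (τ t * N))).of_nonneg_of_le
      (fun j => mul_nonneg (Real.exp_pos _).le (modeEnergy_nonneg _ _ j))
      fun j => mul_le_mul_of_nonneg_right (Real.exp_le_exp.2
        (mul_le_mul_of_nonneg_left (min_le_right _ _) hpos.le)) (modeEnergy_nonneg _ _ j)
  calc _ = ∑ j ∈ A, Real.exp (τ t * truncNorm m N j) *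
        modeEnergy (hat (u t)) (hat (ut t)) j :=
        Finset.sum_congr rfl fun j hj => by rw [htr j hj]
    _ ≤ _ := hs.sum_le_tsum A fun j _ => mul_nonneg (Real.exp_pos _).le (modeEnergy_nonneg _ _ j)
    _ ≤ _ := key N

end Solution

end WaveGevrey

theorem theorem3 (n m : ℕ) (hm : 1 ≤ m) (hmn : m ≤ n)
    (p lam σ T : ℝ) (hp : (n : ℝ) / 2 < p) (hp1 : 1 ≤ p) (hlam : 0 < lam) (hσ : 0 < σ)
    (hT : 0 < T)
    (a : (Fin n → ℤ) → ℕ → ℝ → ℂ) (ha : WaveGevrey.Majorized m p lam T a)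
    (u₀ u₁ : WaveGevrey.L2 n)
    (hu₀ : WaveGevrey.MemH p (WaveGevrey.hat u₀))
    (hu₁ : WaveGevrey.MemH (p - 1) (WaveGevrey.hat u₁))
    (hAu₀ : WaveGevrey.MemGevrey m σ (WaveGevrey.opA (WaveGevrey.hat u₀)))
    (hu₁σ : WaveGevrey.MemGevrey m σ (WaveGevrey.hat u₁))
    (u ut : ℝ → WaveGevrey.L2 n) (utt : ℝ → WaveGevrey.Coeffs n)
    (hu : WaveGevrey.IsSolution p T a u₀ u₁ u ut utt)
    (hint : IntervalIntegrable (WaveGevrey.source m p lam a u) volume 0 T)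
    (τ : ℝ → ℝ) (hτ₀ : τ 0 = min lam σ)
    (hτ : ∀ t ∈ Icc 0 T,
      HasDerivWithinAt τ (-(τ t) ^ 2 * WaveGevrey.hTilde m p lam (min lam σ) a u₀ u₁ u t)
        (Icc 0 T) t) :
    ∀ t ∈ Icc 0 T,
      WaveGevrey.MemGevrey m (τ t) (WaveGevrey.opA (WaveGevrey.hat (u t))) ∧
        WaveGevrey.MemGevrey m (τ t) (WaveGevrey.hat (ut t)) := by
  have hn : 1 ≤ n := hm.trans hmn
  have h0 := WaveGevrey.summable_initialEnergy (min_le_right lam σ) hAu₀ hu₁σ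
  have hint' : IntegrableOn (WaveGevrey.source m p lam a u) (Icc 0 T) := by
    rw [integrableOn_Icc_iff_integrableOn_Ioc]
    exact (intervalIntegrable_iff_integrableOn_Ioc_of_le hT.le).1 hint
  intro t ht
  obtain ⟨h1, h2⟩ := hu.summable_exp_mul_modeEnergy hn hp (zero_le_one.trans hp1) ha hint'
    (le_min hlam.le hσ.le) (min_le_left _ _) h0 hτ₀ hτ ht
  exact ⟨.of_modeEnergy h1 h2 (WaveGevrey.norm_opA_le_modeEnergy _ _),
    .of_modeEnergy h1 h2 (WaveGevrey.norm_le_modeEnergy _ _)⟩
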